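/- Let $M$ be a von Neumann algebra on a complex Hilbert space $H$, with commutant $M'$ and center $Z(M)=M\cap M'$. **Locally measurable operators.** A subspace $\mathcal D\subseteq H$ is affiliated with $M$ if $u\mathcal D\subseteq\mathcal D$ for all unitaries $u\in M'$; an operator $x$ is affiliated with $M$ if its domain $\mathcal D(x)$ is and $u x\xi=xu\xi$ for all such $u$ and all $\xi\in\mathcal D(x)$. A closed operator $x$ affiliated with $M$ is measurable, $x\in S(M)$, if there are projections $p_n\in M$, $p_n\uparrow\mathbf 1$, with $p_n(H)\subseteq\mathcal D(x)$ and $\mathbf 1-p_n$ finite in $M$; it is locally measurable, $x\in LS(M)$, if there are projections $z_n\in Z(M)$, $z_n\uparrow\mathbf 1$, with $z_nx\in S(M)$ for all $n$. Sums, scalar multiples and products of these operators are strong (the closures of the algebraic ones), and for self-adjoint $x,y\in LS(M)$ one writes $x\le y$ if $y-x$ is a positive self-adjoint operator. **Central extension.** $E(M)$ is the set of all $x\in LS(M)$ for which there are mutually orthogonal projections $(z_i)_{i\in I}$ in $Z(M)$ with $\bigvee_i z_i=\mathbf 1$ and $z_ix\in M$ for all $i$; it is a complex vector space. For $x\in E(M)$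 put $|x|=(x^*x)^{1/2}$ and $\|x\|=\inf\{f\in S(Z(M)) : f=f^*,\ |x|\le f\}$, the infimum being taken in the ordered set of self-adjoint elements of $S(Z(M))$. **Topology.** Identify $Z(M)$ by a $*$-isomorphism with $L^\infty(\Omega,\Sigma,\mu)$, hence $S(Z(M))$ with $L^0(\Omega,\Sigma,\mu)$, where $\mu$ has the direct sum property: there is a family of measurable sets $\Omega_i$ with $0<\mu(\Omega_i)<\infty$ such that every $A\in\Sigma$ with $\mu(A)<\infty$ is covered up to a null set by countably many $\Omega_i$, and every $N\in\Sigma$ with $\mu(N\cap\Omega_i)=0$ for all $i$ is null. For $A\in\Sigma$ with $\mu(A)<\infty$ and $\varepsilon,\delta>0$ let $W(A,\varepsilon,\delta)$ be the set of all $f\in S(Z(M))$ for which there is $B\in\Sigma$, $B\subseteq A$, with $\mu(A\setminus B)\le\delta$, $f\chi_B\in L^\infty$ and $\|f\chi_B\|_\infty\le\varepsilon$, and let $O(A,\varepsilon,\delta)=\{x\in E(M):\|x\|\in W(A,\varepsilon,\delta)\}$. The topology $t_c(M)$ on $E(M)$ is the one for which the sets $x+O(A,\varepsilon,\delta)$ form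 a base of neighbourhoods of each $x\in E(M)$. **Statement.** For every such identification of $Z(M)$, the topology $t_c(M)$ is normable (it is the topology of a norm on the complex vector space $E(M)$) if and only if $M$ is $*$-isomorphic to a direct sum $\bigoplus_{j=1}^n M_j$ of finitely many factors $M_j$ (the empty sum, $n=0$, being the zero algebra on $H=\{0\}$). Moreover, $M$ is $*$-isomorphic to such a finite direct sum if and only if there is some identification for which $t_c(M)$ is normable. -/

import Mathlib

open scoped ENNReal
open MeasureTheory

universe u v

namespace VonNeumannAlgebra

noncomputable section

set_option linter.unusedSectionVars false

variable {H : Type u} [NormedAddCommGroup H] [InnerProductSpace ℂ H] [CompleteSpace H]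

/-! ### Projections, affiliation, measurable and locally measurable operators

Unbounded operators on `H` are Mathlib's partially defined linear maps `H →ₗ.[ℂ] H`. -/

/-- The center `Z(M) = M ∩ M'`, again a von Neumann algebra on `H`. -/
def center (M : VonNeumannAlgebra H) : VonNeumannAlgebra H where
  toStarSubalgebra := M.toStarSubalgebra ⊓ M.commutant.toStarSubalgebra
  centralizer_centralizer' := by
    apply Set.Subset.antisymm _ Set.subset_centralizer_centralizer
    intro a ha
    constructor
    · have h : a ∈ Set.centralizer (Set.centralizer (M : Set (H →L[ℂ] H))) :=
        Set.centralizer_subset (Set.centralizer_subset fun b hb => hb.1) ha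
      rw [M.centralizer_centralizer] at h
      exact h
    · have h : a ∈ Set.centralizer (Set.centralizer (M.commutant : Set (H →L[ℂ] H))) :=
        Set.centralizer_subset (Set.centralizer_subset fun b hb => hb.2) ha
      rw [M.commutant.centralizer_centralizer] at h
      exact h

/-- `p ∈ P(M)`: `p` is an (orthogonal) projection belonging to `M`. -/
def IsProj (M : VonNeumannAlgebra H) (p : H →L[ℂ] H) : Prop :=
  IsStarProjection p ∧ p ∈ M

/-- The join of the projections in `P` is the identity. -/
def JoinEqOne (P : Set (H →L[ℂ] H)) : Prop :=
  ∀ ξ : H, (∀ p ∈ P, p ξ = 0) → ξ = 0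

/-- `p n ↑ 1` for a sequence of projections. -/
def IncreasesToOne (p : ℕ → H →L[ℂ] H) : Prop :=
  Monotone p ∧ JoinEqOne (Set.range p)

/-- A finite projection of `M`: it is not equivalent in `M` to a proper subprojection. -/
def IsFiniteProj (M : VonNeumannAlgebra H) (p : H →L[ℂ] H) : Prop :=
  M.IsProj p ∧ ∀ w ∈ M, star w * w = p → w * star w ≤ p → w * star w = p

/-- The subspace `D` is affiliated with `M`. -/
def AffiliatedSubspace (M : VonNeumannAlgebra H) (D : Submodule ℂ H) : Prop :=
  ∀ w ∈ unitary (H →L[ℂ] H), w ∈ M.commutant → ∀ ξ ∈ D, w ξ ∈ D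

/-- The operator `x` is affiliated with `M`. -/
def Affiliated (M : VonNeumannAlgebra H) (x : H →ₗ.[ℂ] H) : Prop :=
  ∀ w ∈ unitary (H →L[ℂ] H), w ∈ M.commutant →
    ∀ ξ : x.domain, ∃ h : w ξ ∈ x.domain, x ⟨w ξ, h⟩ = w (x ξ)

/-- The subspace `D` is strongly dense in `H` with respect to `M`. -/
def StronglyDense (M : VonNeumannAlgebra H) (D : Submodule ℂ H) : Prop :=
  M.AffiliatedSubspace D ∧
    ∃ p : ℕ → H →L[ℂ] H, (∀ n, M.IsProj (p n)) ∧ IncreasesToOne p ∧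
      (∀ n ξ, p n ξ ∈ D) ∧ ∀ n, M.IsFiniteProj (1 - p n)

/-- `x ∈ S(M)`: `x` is measurable with respect to `M`. -/
def IsMeasurable (M : VonNeumannAlgebra H) (x : H →ₗ.[ℂ] H) : Prop :=
  x.IsClosed ∧ M.Affiliated x ∧ M.StronglyDense x.domain

/-- The strong product of a bounded operator and an unbounded one. -/
def strongMul (z : H →L[ℂ] H) (x : H →ₗ.[ℂ] H) : H →ₗ.[ℂ] H :=
  ((z : H →ₗ[ℂ] H).compPMap x).closure

/-- The strong sum of two unbounded operators. -/
def strongAdd (x y : H →ₗ.[ℂ] H) : H →ₗ.[ℂ] H := (x + y).closure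

/-- The strong difference of two unbounded operators. -/
def strongSub (x y : H →ₗ.[ℂ] H) : H →ₗ.[ℂ] H := (x - y).closure

/-- The product of an unbounded operator by a scalar (the closure matters only for `0 • x`). -/
def strongSMul (c : ℂ) (x : H →ₗ.[ℂ] H) : H →ₗ.[ℂ] H := (c • x).closure

/-- A bounded operator as an everywhere defined partial linear map. -/
def ofBounded (a : H →L[ℂ] H) : H →ₗ.[ℂ] H := (a : H →ₗ[ℂ] H).toPMap ⊤

/-- `x ∈ LS(M)`: `x` is locally measurable with respect to `M`. -/
def IsLocallyMeasurable (M : VonNeumannAlgebra H) (x : H →ₗ.[ℂ] H) : Prop :=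
  x.IsClosed ∧ M.Affiliated x ∧
    ∃ z : ℕ → H →L[ℂ] H, (∀ n, M.center.IsProj (z n)) ∧ IncreasesToOne z ∧
      ∀ n, M.IsMeasurable (strongMul (z n) x)

/-- `x ∈ E(M)`: `x` is locally measurable and there is a family of mutually orthogonal central
projections `z` with join `1` such that each `z x` belongs to `M`. -/
def IsCentralExtensionElement (M : VonNeumannAlgebra H) (x : H →ₗ.[ℂ] H) : Prop :=
  M.IsLocallyMeasurable x ∧
    ∃ Z : Set (H →L[ℂ] H), (∀ z ∈ Z, M.center.IsProj z) ∧
      (Z.Pairwise fun z w => z * w = 0) ∧ JoinEqOne Z ∧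
      ∀ z ∈ Z, ∃ a ∈ M, strongMul z x = ofBounded a

/-- The central extension `E(M)` of `M`. -/
def CentralExtension (M : VonNeumannAlgebra H) : Type u :=
  {x : H →ₗ.[ℂ] H // M.IsCentralExtensionElement x}

/-! ### Auxiliary facts: `E(M)` is a complex vector space for the strong operations -/

/-- On the domain of `x`, the operator `g x` is given by the bounded operator `c`. -/
def Cut (x : H →ₗ.[ℂ] H) (g c : H →L[ℂ] H) : Prop :=
  ∀ ξ : x.domain, g (x ξ) = c ξ

theorem cut_iff_graph {x : H →ₗ.[ℂ] H} {g c : H →L[ℂ] H} :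
    Cut x g c ↔ ∀ p ∈ x.graph, g p.2 = c p.1 := by
  constructor
  · intro h p hp
    obtain ⟨y, h1, h2⟩ := (LinearPMap.mem_graph_iff x).1 hp
    rw [← h1, ← h2]; exact h y
  · intro h ξ
    exact h (ξ, x ξ) (x.mem_graph ξ)

theorem Cut.closure {x : H →ₗ.[ℂ] H} {g c : H →L[ℂ] H} (h : Cut x g c) : Cut x.closure g c := by
  by_cases hx : x.IsClosable
  · rw [cut_iff_graph] at h ⊢
    rw [← hx.graph_closure_eq_closure_graph]
    intro p hp
    have hcl : IsClosed {p : H × H | g p.2 = c p.1} :=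
      isClosed_eq (g.continuous.comp continuous_snd) (c.continuous.comp continuous_fst)
    have : _root_.closure (x.graph : Set (H × H)) ⊆ {p : H × H | g p.2 = c p.1} :=
      closure_minimal (fun p hp => h p hp) hcl
    exact this hp
  · rw [LinearPMap.closure_def' hx]; exact h

theorem Cut.mul {x : H →ₗ.[ℂ] H} {g c : H →L[ℂ] H} (h : Cut x g c) (w : H →L[ℂ] H) :
    Cut x (w * g) (w * c) := fun ξ => by
  simp [h ξ]

theorem Cut.add {x y : H →ₗ.[ℂ] H} {g a b : H →L[ℂ] H} (h : Cut x g a) (h' : Cut y g b) :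
    Cut (strongAdd x y) g (a + b) :=
  Cut.closure fun ξ => by
    rw [LinearPMap.add_apply, map_add, h, h']; rfl

theorem Cut.smul {x : H →ₗ.[ℂ] H} {g a : H →L[ℂ] H} (h : Cut x g a) (c : ℂ) :
    Cut (strongSMul c x) g (c • a) :=
  Cut.closure fun ξ => by
    rw [LinearPMap.smul_apply, map_smul]
    exact congrArg (c • ·) (h ξ)

theorem ofBounded_isClosed (a : H →L[ℂ] H) : (ofBounded a).IsClosed := by
  have : ((ofBounded a).graph : Set (H × H)) = {p | p.2 = a p.1} := by
    ext p
    simp only [SetLike.mem_coe, LinearPMap.mem_graph_iff, Set.mem_ofPred_eq]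
    constructor
    · rintro ⟨y, h1, h2⟩
      rw [← h1, ← h2]; rfl
    · intro hp
      exact ⟨⟨p.1, trivial⟩, rfl, hp.symm⟩
  rw [LinearPMap.IsClosed, this]
  exact isClosed_eq continuous_snd (a.continuous.comp continuous_fst)

theorem strongMul_eq_ofBounded_iff {x : H →ₗ.[ℂ] H} (hx : Dense (x.domain : Set H))
    {z a : H →L[ℂ] H} : strongMul z x = ofBounded a ↔ Cut x z a := by
  constructor
  · intro h ξ
    have hle : (z : H →ₗ[ℂ] H).compPMap x ≤ ofBounded a := h ▸ LinearPMap.le_closure _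
    exact hle.2 (x := ξ) (y := ⟨ξ, trivial⟩) rfl
  · intro h
    have hle : (z : H →ₗ[ℂ] H).compPMap x ≤ ofBounded a := by
      refine ⟨fun _ _ => trivial, fun ξ η hξη => ?_⟩
      have := h ξ
      rw [hξη] at this
      exact this
    have hcl := ofBounded_isClosed a
    have hcb := hcl.isClosable.leIsClosable hle
    apply LinearPMap.eq_of_eq_graph
    apply le_antisymm
    · rw [strongMul, ← hcb.graph_closure_eq_closure_graph]
      exact Submodule.topologicalClosure_minimal _ (LinearPMap.le_graph_of_le hle) hcl
    · rintro ⟨ξ, η⟩ hp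
      obtain ⟨y, h1, h2⟩ := (LinearPMap.mem_graph_iff _).1 hp
      have h2' : a ξ = η := by
        change (y : H) = ξ at h1
        change a y = η at h2
        rw [← h1, h2]
      rw [strongMul, ← hcb.graph_closure_eq_closure_graph]
      change (ξ, η) ∈ closure _
      have hc : Continuous fun ζ : H => (ζ, a ζ) := by fun_prop
      have := image_closure_subset_closure_image hc (s := (x.domain : Set H)) ⟨ξ, hx ξ, rfl⟩
      simp only [h2'] at this
      refine closure_mono ?_ this
      rintro _ ⟨ζ, hζ, rfl⟩
      exact (LinearPMap.mem_graph_iff _).2 ⟨⟨ζ, hζ⟩, rfl, h ⟨ζ, hζ⟩⟩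

theorem domain_closure_subset (x : H →ₗ.[ℂ] H) :
    (x.closure.domain : Set H) ⊆ closure (x.domain : Set H) := by
  intro ξ hξ
  by_cases hx : x.IsClosable
  · obtain ⟨η, h⟩ := LinearPMap.mem_domain_iff.1 hξ
    rw [← hx.graph_closure_eq_closure_graph] at h
    have h' : (ξ, η) ∈ closure (x.graph : Set (H × H)) := h
    have := image_closure_subset_closure_image continuous_fst ⟨_, h', rfl⟩
    refine closure_mono ?_ this
    rintro _ ⟨p, hp, rfl⟩
    exact LinearPMap.mem_domain_of_mem_graph (x := p.1) (y := p.2) hp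
  · rw [LinearPMap.closure_def' hx] at hξ
    exact subset_closure hξ

theorem starProjection_inner {p : H →L[ℂ] H} (hp : IsStarProjection p) (ξ η : H) :
    inner ℂ (p ξ) η = inner ℂ ξ (p η) := by
  rw [← ContinuousLinearMap.adjoint_inner_right, ← ContinuousLinearMap.star_eq_adjoint,
    hp.isSelfAdjoint.star_eq]

theorem starProjection_apply_apply {p : H →L[ℂ] H} (hp : IsStarProjection p) (ξ : H) :
    p (p ξ) = p ξ := congrArg (fun q : H →L[ℂ] H => q ξ) hp.isIdempotentElem.eq

theorem norm_starProjection_le {p : H →L[ℂ] H} (hp : IsStarProjection p) (ξ : H) :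
    ‖p ξ‖ ≤ ‖ξ‖ := by
  have h1 : ‖p ξ‖ ^ 2 ≤ ‖p ξ‖ * ‖ξ‖ := by
    have h2 : inner ℂ (p ξ) ξ = inner ℂ (p ξ) (p ξ) := by
      rw [starProjection_inner hp, starProjection_inner hp, starProjection_apply_apply hp]
    have h3 := norm_inner_le_norm (𝕜 := ℂ) (p ξ) ξ
    rw [h2, inner_self_eq_norm_sq_to_K, norm_pow] at h3
    simpa using h3
  rcases (norm_nonneg (p ξ)).eq_or_lt with h | h
  · rw [← h]; exact norm_nonneg _
  · nlinarith

/-- A family of projections with join `1` has ranges spanning a dense subspace. -/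
theorem dense_span_of_joinEqOne {P : Set (H →L[ℂ] H)} (hP : ∀ p ∈ P, IsStarProjection p)
    (h : JoinEqOne P) :
    Dense (Submodule.span ℂ {ξ : H | ∃ p ∈ P, p ξ = ξ} : Set H) := by
  rw [Submodule.dense_iff_topologicalClosure_eq_top, Submodule.topologicalClosure_eq_top_iff,
    Submodule.eq_bot_iff]
  intro η hη
  apply h
  intro p hp
  rw [Submodule.mem_orthogonal] at hη
  have h0 := hη (p η) (Submodule.subset_span ⟨p, hp, starProjection_apply_apply (hP p hp) η⟩)
  rw [← inner_self_eq_zero (𝕜 := ℂ), ← starProjection_inner (hP p hp),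
    starProjection_apply_apply (hP p hp)]
  exact h0

theorem commute_of_mem_center {M : VonNeumannAlgebra H} {z y : H →L[ℂ] H} (hz : z ∈ M.center)
    (hy : y ∈ M ∨ y ∈ M.commutant) : z * y = y * z := by
  have h1 : z ∈ M := hz.1
  have h2 : z ∈ M.commutant := hz.2
  rcases hy with hy | hy
  · exact ((mem_commutant_iff.1 h2) y hy).symm
  · exact (mem_commutant_iff.1 hy) z h1

theorem affiliated_central {M : VonNeumannAlgebra H} {x : H →ₗ.[ℂ] H} (hx : M.Affiliated x)
    {z : H →L[ℂ] H} (hz : M.center.IsProj z) (ξ : x.domain) :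
    ∃ h : z ξ ∈ x.domain, x ⟨z ξ, h⟩ = z (x ξ) := by
  have hu : (2 * z - 1 : H →L[ℂ] H) ∈ M.commutant :=
    sub_mem (mul_mem (by exact ofNat_mem M.commutant 2) hz.2.2) (one_mem _)
  obtain ⟨h, e⟩ := hx _ hz.1.two_mul_sub_one_mem_unitary hu ξ
  have key : ∀ v : H, z v = (2⁻¹ : ℂ) • ((2 * z - 1 : H →L[ℂ] H) v + v) := by
    intro v
    have : (2 * z - 1 : H →L[ℂ] H) v + v = (2 : ℂ) • z v := by
      rw [two_mul, two_smul]; simp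
    rw [this, smul_smul]; norm_num
  have hm : z ξ ∈ x.domain := by
    rw [key]; exact x.domain.smul_mem _ (x.domain.add_mem h ξ.2)
  refine ⟨hm, ?_⟩
  have : (⟨z ξ, hm⟩ : x.domain)
      = (2⁻¹ : ℂ) • ((⟨(2 * z - 1 : H →L[ℂ] H) ξ, h⟩ : x.domain) + ξ) := Subtype.ext (key ξ)
  rw [this, x.map_smul, x.map_add, e, key]

theorem Affiliated.graph {M : VonNeumannAlgebra H} {x : H →ₗ.[ℂ] H} (hx : M.Affiliated x)
    {w : H →L[ℂ] H} (hw : w ∈ unitary (H →L[ℂ] H)) (hw' : w ∈ M.commutant) {p : H × H}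
    (hp : p ∈ x.graph) : (w p.1, w p.2) ∈ x.graph := by
  obtain ⟨y, h1, h2⟩ := (LinearPMap.mem_graph_iff x).1 hp
  obtain ⟨h, e⟩ := hx w hw hw' y
  rw [← h1, ← h2, ← e]
  exact x.mem_graph ⟨w y, h⟩

theorem Affiliated.closure {M : VonNeumannAlgebra H} {x : H →ₗ.[ℂ] H} (hx : M.Affiliated x) :
    M.Affiliated x.closure := by
  by_cases hc : x.IsClosable
  · intro w hw hw' ξ
    have h1 : ((ξ : H), x.closure ξ) ∈ _root_.closure (x.graph : Set (H × H)) := by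
      have := x.closure.mem_graph ξ
      rw [← hc.graph_closure_eq_closure_graph] at this
      exact this
    have hcont : Continuous fun p : H × H => (w p.1, w p.2) := by fun_prop
    have h2 := image_closure_subset_closure_image hcont ⟨_, h1, rfl⟩
    have h3 : (w ξ, w (x.closure ξ)) ∈ x.closure.graph := by
      rw [← hc.graph_closure_eq_closure_graph]
      refine closure_mono ?_ h2
      rintro _ ⟨p, hp, rfl⟩
      exact hx.graph hw hw' hp
    obtain ⟨y, e1, e2⟩ := (LinearPMap.mem_graph_iff _).1 h3
    have hm : w ξ ∈ x.closure.domain := LinearPMap.mem_domain_of_mem_graph h3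
    refine ⟨hm, ?_⟩
    have : y = ⟨w ξ, hm⟩ := Subtype.ext e1
    rw [← this]; exact e2
  · rw [LinearPMap.closure_def' hc]; exact hx

/-- An increasing sequence of central projections converging strongly to the identity. -/
structure Exhaustion (M : VonNeumannAlgebra H) (e : ℕ → H →L[ℂ] H) : Prop where
  proj : ∀ n, M.center.IsProj (e n)
  mono : Monotone e
  tendsto : ∀ ξ, Filter.Tendsto (fun n => e n ξ) Filter.atTop (nhds ξ)

theorem Exhaustion.eq_zero {M : VonNeumannAlgebra H} {e : ℕ → H →L[ℂ] H} (he : M.Exhaustion e)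
    {ξ : H} (h : ∀ n, e n ξ = 0) : ξ = 0 :=
  tendsto_nhds_unique (he.tendsto ξ) (by simp [h])

theorem Exhaustion.increases {M : VonNeumannAlgebra H} {e : ℕ → H →L[ℂ] H}
    (he : M.Exhaustion e) : IncreasesToOne e :=
  ⟨he.mono, fun _ h => he.eq_zero fun n => h _ ⟨n, rfl⟩⟩

theorem IsProj.central_mul {M : VonNeumannAlgebra H} {p q : H →L[ℂ] H}
    (hp : M.center.IsProj p) (hq : M.center.IsProj q) : M.center.IsProj (p * q) :=
  ⟨hp.1.mul hq.1 (commute_of_mem_center hp.2 (Or.inl hq.2.1)), mul_mem hp.2 hq.2⟩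

theorem Exhaustion.mul {M : VonNeumannAlgebra H} {e f : ℕ → H →L[ℂ] H}
    (he : M.Exhaustion e) (hf : M.Exhaustion f) : M.Exhaustion fun n => e n * f n where
  proj n := (he.proj n).central_mul (hf.proj n)
  mono m n hmn := by
    have h1 := ((he.proj m).1.le_iff_mul_eq_left (he.proj n).1).1 (he.mono hmn)
    have h2 := ((hf.proj m).1.le_iff_mul_eq_left (hf.proj n).1).1 (hf.mono hmn)
    refine (((he.proj m).central_mul (hf.proj m)).1.le_iff_mul_eq_left
      ((he.proj n).central_mul (hf.proj n)).1).2 ?_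
    have hc : e n * f m = f m * e n :=
      commute_of_mem_center (he.proj n).2 (Or.inl (hf.proj m).2.1)
    calc e m * f m * (e n * f n) = e m * (f m * e n) * f n := by simp only [mul_assoc]
      _ = (e m * e n) * (f m * f n) := by rw [← hc]; simp only [mul_assoc]
      _ = e m * f m := by rw [h1, h2]
  tendsto ξ := by
    have h1 : Filter.Tendsto (fun n => e n (f n ξ - ξ)) Filter.atTop (nhds 0) := by
      have h2 : Filter.Tendsto (fun n => ‖f n ξ - ξ‖) Filter.atTop (nhds 0) := by
        have := ((hf.tendsto ξ).sub_const ξ).norm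
        simpa using this
      exact squeeze_zero_norm (fun n => norm_starProjection_le (he.proj n).1 _) h2
    have h3 := h1.add (he.tendsto ξ)
    simpa using h3

theorem mem_graph_of_cut {M : VonNeumannAlgebra H} {x : H →ₗ.[ℂ] H} (hc : x.IsClosed)
    (ha : M.Affiliated x) (hd : Dense (x.domain : Set H)) {e a : ℕ → H →L[ℂ] H}
    (he : M.Exhaustion e) (hcut : ∀ n, Cut x (e n) (a n)) (p : H × H) :
    p ∈ x.graph ↔ ∀ n, e n p.2 = a n p.1 := by
  constructor
  · intro hp n
    exact cut_iff_graph.1 (hcut n) p hp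
  · intro h
    -- `(e n ξ, a n ξ)` lies in the graph for every `ξ`
    have key : ∀ n ξ, (e n ξ, a n ξ) ∈ x.graph := by
      intro n
      have hcl : _root_.IsClosed {ξ : H | (e n ξ, a n ξ) ∈ x.graph} :=
        IsClosed.preimage (f := fun ξ : H => (e n ξ, a n ξ)) (by fun_prop) hc
      intro ξ
      refine (hcl.closure_subset_iff (s := (x.domain : Set H))).2 ?_ (hd ξ)
      intro ζ hζ
      obtain ⟨h1, h2⟩ := affiliated_central ha (he.proj n) ⟨ζ, hζ⟩
      have h3 := x.mem_graph ⟨_, h1⟩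
      rw [h2, hcut n] at h3
      exact h3
    have ht : Filter.Tendsto (fun n => (e n p.1, e n p.2)) Filter.atTop (nhds (p.1, p.2)) :=
      (he.tendsto p.1).prodMk_nhds (he.tendsto p.2)
    refine IsClosed.mem_of_tendsto (s := (x.graph : Set (H × H))) hc ht
      (Filter.Eventually.of_forall fun n => ?_)
    rw [h n]
    exact key n p.1

theorem eq_of_cut {M : VonNeumannAlgebra H} {x y : H →ₗ.[ℂ] H} (hcx : x.IsClosed)
    (hax : M.Affiliated x) (hdx : Dense (x.domain : Set H)) (hcy : y.IsClosed)
    (hay : M.Affiliated y) (hdy : Dense (y.domain : Set H)) {e a : ℕ → H →L[ℂ] H}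
    (he : M.Exhaustion e) (hx : ∀ n, Cut x (e n) (a n)) (hy : ∀ n, Cut y (e n) (a n)) : x = y := by
  apply LinearPMap.eq_of_eq_graph
  ext p
  rw [mem_graph_of_cut hcx hax hdx he hx, mem_graph_of_cut hcy hay hdy he hy]

/-- The projection onto a closed subspace invariant under `M` and `M'` is central. -/
theorem isProj_center_starProjection {M : VonNeumannAlgebra H} (K : Submodule ℂ H)
    [K.HasOrthogonalProjection]
    (h : ∀ y : H →L[ℂ] H, (y ∈ M ∨ y ∈ M.commutant) → ∀ ξ ∈ K, y ξ ∈ K) :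
    M.center.IsProj K.starProjection := by
  have hp : IsStarProjection K.starProjection := isStarProjection_starProjection
  refine ⟨hp, ?_, ?_⟩
  · refine (VonNeumannAlgebra.IsStarProjection.mem_iff hp M).2 fun y hy => ?_
    intro ξ hξ
    rw [Submodule.range_starProjection] at hξ
    rw [Submodule.mem_comap, Submodule.range_starProjection]
    exact h y (Or.inr hy) ξ hξ
  · refine (VonNeumannAlgebra.IsStarProjection.mem_iff hp M.commutant).2 fun y hy => ?_
    rw [commutant_commutant] at hy
    intro ξ hξ
    rw [Submodule.range_starProjection] at hξ
    rw [Submodule.mem_comap, Submodule.range_starProjection]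
    exact h y (Or.inl hy) ξ hξ

theorem ofBounded_isMeasurable {M : VonNeumannAlgebra H} {a : H →L[ℂ] H} (ha : a ∈ M) :
    M.IsMeasurable (ofBounded a) := by
  refine ⟨ofBounded_isClosed a, fun w _ hw ξ => ⟨trivial, ?_⟩, fun w _ _ ξ _ => trivial,
    fun _ => 1, fun _ => ⟨.one _, one_mem M⟩, ⟨monotone_const, fun ξ h => ?_⟩,
    fun _ _ => trivial, fun _ => ?_⟩
  · exact congrArg (fun q : H →L[ℂ] H => q ξ) (mem_commutant_iff.1 hw a ha)
  · exact h 1 ⟨0, rfl⟩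
  · rw [sub_self]
    refine ⟨⟨.zero _, zero_mem M⟩, fun w _ h _ => ?_⟩
    rw [CStarRing.star_mul_self_eq_zero_iff] at h
    simp [h]

theorem IsLocallyMeasurable.dense {M : VonNeumannAlgebra H} {x : H →ₗ.[ℂ] H}
    (hx : M.IsLocallyMeasurable x) : Dense (x.domain : Set H) := by
  obtain ⟨-, -, z, -, -, hz⟩ := hx
  obtain ⟨-, -, -, p, hp, hp1, hpD, -⟩ := hz 0
  have h1 := dense_span_of_joinEqOne (P := Set.range p)
    (by rintro _ ⟨n, rfl⟩; exact (hp n).1) hp1.2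
  have h2 : Submodule.span ℂ {ξ : H | ∃ q ∈ Set.range p, q ξ = ξ} ≤ (strongMul (z 0) x).domain := by
    rw [Submodule.span_le]
    rintro ξ ⟨_, ⟨n, rfl⟩, h⟩
    have := hpD n ξ
    rw [h] at this
    exact this
  have h3 : Dense ((strongMul (z 0) x).domain : Set H) := h1.mono h2
  exact dense_closure.1 (h3.mono (domain_closure_subset ((z 0 : H →ₗ[ℂ] H).compPMap x)))

theorem isCentralExtensionElement_of_cut {M : VonNeumannAlgebra H} {x : H →ₗ.[ℂ] H}
    (hc : x.IsClosed) (ha : M.Affiliated x) (hd : Dense (x.domain : Set H))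
    {e a : ℕ → H →L[ℂ] H} (he : M.Exhaustion e) (haM : ∀ n, a n ∈ M)
    (hcut : ∀ n, Cut x (e n) (a n)) : M.IsCentralExtensionElement x := by
  refine ⟨⟨hc, ha, e, he.proj, he.increases, fun n => ?_⟩, ?_⟩
  · rw [(strongMul_eq_ofBounded_iff hd).2 (hcut n)]
    exact ofBounded_isMeasurable (haM n)
  · let e' : ℕ → H →L[ℂ] H := fun n => Nat.casesOn n 0 e
    let a' : ℕ → H →L[ℂ] H := fun n => Nat.casesOn n 0 a
    have hmul : ∀ m n, m ≤ n → e m * e n = e m ∧ e n * e m = e m := fun m n hmn =>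
      ⟨((he.proj m).1.le_iff_mul_eq_left (he.proj n).1).1 (he.mono hmn),
        ((he.proj m).1.le_iff_mul_eq_right (he.proj n).1).1 (he.mono hmn)⟩
    have hlt : ∀ m n, m < n → (e m - e' m) * (e n - e' n) = 0 := by
      intro m n hmn
      obtain ⟨k, rfl⟩ : ∃ k, n = k + 1 := ⟨n - 1, by omega⟩
      change (e m - e' m) * (e (k + 1) - e k) = 0
      have h1 : e m * (e (k + 1) - e k) = 0 := by
        rw [mul_sub, (hmul m (k + 1) (by omega)).1, (hmul m k (by omega)).1, sub_self]
      have h2 : e' m * (e (k + 1) - e k) = 0 := by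
        cases m with
        | zero => exact zero_mul _
        | succ j =>
          change e j * (e (k + 1) - e k) = 0
          rw [mul_sub, (hmul j (k + 1) (by omega)).1, (hmul j k (by omega)).1, sub_self]
      rw [sub_mul, h1, h2, sub_self]
    have hproj : ∀ n, M.center.IsProj (e n - e' n) := by
      intro n
      cases n with
      | zero =>
        change M.center.IsProj (e 0 - 0)
        rw [sub_zero]; exact he.proj 0
      | succ k =>
        exact ⟨((he.proj k).1.le_iff_sub (he.proj (k + 1)).1).1 (he.mono (Nat.le_succ k)),
          sub_mem (he.proj (k + 1)).2 (he.proj k).2⟩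
    refine ⟨Set.range fun n => e n - e' n, ?_, ?_, ?_, ?_⟩
    · rintro _ ⟨n, rfl⟩; exact hproj n
    · rintro _ ⟨m, rfl⟩ _ ⟨n, rfl⟩ hne
      rcases lt_trichotomy m n with h | h | h
      · exact hlt m n h
      · exact absurd (by rw [h]) hne
      · change (e m - e' m) * (e n - e' n) = 0
        rw [commute_of_mem_center (hproj m).2 (Or.inl (hproj n).2.1)]
        exact hlt n m h
    · intro ξ h
      refine he.eq_zero fun n => ?_
      induction n with
      | zero =>
        have := h _ ⟨0, rfl⟩
        change (e 0 - 0) ξ = 0 at this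
        rwa [sub_zero] at this
      | succ k ih =>
        have := h _ ⟨k + 1, rfl⟩
        change e (k + 1) ξ - e k ξ = 0 at this
        rwa [ih, sub_zero] at this
    · rintro _ ⟨n, rfl⟩
      cases n with
      | zero =>
        refine ⟨a 0, haM 0, ?_⟩
        change strongMul (e 0 - 0) x = _
        rw [sub_zero]
        exact (strongMul_eq_ofBounded_iff hd).2 (hcut 0)
      | succ k =>
        refine ⟨a (k + 1) - a k, sub_mem (haM _) (haM _), (strongMul_eq_ofBounded_iff hd).2 ?_⟩
        intro ξ
        change e (k + 1) (x ξ) - e k (x ξ) = a (k + 1) ξ - a k ξ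
        rw [hcut, hcut]

theorem norm_sum_le_of_orthogonal {Z : Set (H →L[ℂ] H)} (hZ : ∀ z ∈ Z, IsStarProjection z)
    (hO : Z.Pairwise fun z w => z * w = 0) {C : ℝ} (ξ η : H)
    (h : ∀ z ∈ Z, ‖z η‖ ≤ C * ‖z ξ‖) (F : Finset (H →L[ℂ] H)) (hF : ∀ z ∈ F, z ∈ Z) :
    ‖∑ z ∈ F, z η‖ ^ 2 ≤ C ^ 2 * ‖∑ z ∈ F, z ξ‖ ^ 2 := by
  classical
  induction F using Finset.induction_on with
  | empty => simp
  | insert z F hz ih =>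
    have horth : ∀ v : H, inner ℂ (z v) (∑ w ∈ F, w v) = 0 := by
      intro v
      rw [inner_sum]
      refine Finset.sum_eq_zero fun w hw => ?_
      have hzw : z * w = 0 := hO (hF z (Finset.mem_insert_self _ _))
        (hF w (Finset.mem_insert_of_mem hw)) (fun h => hz (h ▸ hw))
      rw [starProjection_inner (hZ z (hF z (Finset.mem_insert_self _ _)))]
      have : z (w v) = 0 := congrArg (fun q : H →L[ℂ] H => q v) hzw
      rw [this, inner_zero_right]
    rw [Finset.sum_insert hz, Finset.sum_insert hz]
    have e1 := norm_add_sq_eq_norm_sq_add_norm_sq_of_inner_eq_zero (𝕜 := ℂ) _ _ (horth η)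
    have e2 := norm_add_sq_eq_norm_sq_add_norm_sq_of_inner_eq_zero (𝕜 := ℂ) _ _ (horth ξ)
    have i1 := ih fun w hw => hF w (Finset.mem_insert_of_mem hw)
    have i2 := h z (hF z (Finset.mem_insert_self _ _))
    have i3 : ‖z η‖ ^ 2 ≤ (C * ‖z ξ‖) ^ 2 := pow_le_pow_left₀ (norm_nonneg _) i2 2
    nlinarith

theorem norm_le_of_orthogonal {Z : Set (H →L[ℂ] H)} (hZ : ∀ z ∈ Z, IsStarProjection z)
    (hO : Z.Pairwise fun z w => z * w = 0) (hJ : JoinEqOne Z) {C : ℝ} (hC : 0 ≤ C) (ξ η : H)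
    (h : ∀ z ∈ Z, ‖z η‖ ≤ C * ‖z ξ‖) : ‖η‖ ≤ C * ‖ξ‖ := by
  classical
  let D := Submodule.span ℂ {v : H | ∃ p ∈ Z, p v = v}
  have hmul : ∀ z ∈ Z, ∀ v, z (z v) = z v := fun z hz v => starProjection_apply_apply (hZ z hz) v
  -- every vector of the dense span is fixed by some finite sum
  have hfix : ∀ v ∈ D, ∃ F : Finset (H →L[ℂ] H), (∀ z ∈ F, z ∈ Z) ∧
      ∀ G : Finset (H →L[ℂ] H), F ⊆ G → (∀ z ∈ G, z ∈ Z) → ∑ z ∈ G, z v = v := by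
    intro v hv
    induction hv using Submodule.span_induction with
    | mem v hv =>
      obtain ⟨p, hp, hpv⟩ := hv
      refine ⟨{p}, by simpa using hp, fun G hG hGZ => ?_⟩
      rw [Finset.sum_eq_single_of_mem p (hG (Finset.mem_singleton_self p)), hpv]
      intro w hw hne
      have : w * p = 0 := hO (hGZ w hw) hp hne
      rw [← hpv]
      exact congrArg (fun q : H →L[ℂ] H => q v) this
    | zero => exact ⟨∅, by simp, fun G _ _ => by simp⟩
    | add v w _ _ hv hw =>
      obtain ⟨F, hF, hF'⟩ := hv
      obtain ⟨G, hG, hG'⟩ := hw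
      refine ⟨F ∪ G, ?_, fun K hK hKZ => ?_⟩
      · intro z hz
        rcases Finset.mem_union.1 hz with h | h
        exacts [hF z h, hG z h]
      · simp only [map_add, Finset.sum_add_distrib]
        rw [hF' K (Finset.union_subset_left hK) hKZ, hG' K (Finset.union_subset_right hK) hKZ]
    | smul c v _ hv =>
      obtain ⟨F, hF, hF'⟩ := hv
      refine ⟨F, hF, fun K hK hKZ => ?_⟩
      simp only [map_smul, ← Finset.smul_sum]
      rw [hF' K hK hKZ]
  have hadj : ∀ F : Finset (H →L[ℂ] H), (∀ z ∈ F, z ∈ Z) → ∀ v w : H,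
      inner ℂ (∑ z ∈ F, z v) w = inner ℂ v (∑ z ∈ F, z w) := by
    intro F hF v w
    rw [sum_inner, inner_sum]
    exact Finset.sum_congr rfl fun z hz => starProjection_inner (hZ z (hF z hz)) v w
  -- finite sums are contractions
  have hcontr : ∀ F : Finset (H →L[ℂ] H), (∀ z ∈ F, z ∈ Z) → ∀ v : H,
      ‖∑ z ∈ F, z v‖ ≤ ‖v‖ := by
    intro F hF v
    have hidem : ∑ z ∈ F, z (∑ w ∈ F, w v) = ∑ z ∈ F, z v := by
      refine Finset.sum_congr rfl fun z hz => ?_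
      rw [map_sum, Finset.sum_eq_single_of_mem z hz, hmul z (hF z hz)]
      intro w hw hne
      exact congrArg (fun q : H →L[ℂ] H => q v) (hO (hF z hz) (hF w hw) hne.symm)
    have h1 : inner ℂ (∑ z ∈ F, z v) (∑ z ∈ F, z v) = inner ℂ v (∑ z ∈ F, z v) := by
      rw [hadj F hF, hidem]
    have h2 := norm_inner_le_norm (𝕜 := ℂ) v (∑ z ∈ F, z v)
    rw [← h1, inner_self_eq_norm_sq_to_K, norm_pow] at h2
    simp only [Complex.coe_algebraMap, Complex.norm_real, norm_norm] at h2
    rcases (norm_nonneg (∑ z ∈ F, z v)).eq_or_lt with h | h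
    · rw [← h]; exact norm_nonneg _
    · nlinarith
  have hbound : ∀ v : H, ‖inner ℂ η v‖ ≤ C * ‖ξ‖ * ‖v‖ := by
    have hcl : _root_.IsClosed {v : H | ‖inner ℂ η v‖ ≤ C * ‖ξ‖ * ‖v‖} :=
      isClosed_le (by fun_prop) (by fun_prop)
    intro v
    refine (hcl.closure_subset_iff (s := (D : Set H))).2 ?_
      (dense_span_of_joinEqOne hZ hJ v)
    intro w hw
    obtain ⟨F, hF, hF'⟩ := hfix w hw
    have h1 : inner ℂ η w = inner ℂ (∑ z ∈ F, z η) w := by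
      rw [hadj F hF, hF' F subset_rfl hF]
    have h2 := norm_sum_le_of_orthogonal hZ hO ξ η h F hF
    have h3 : ‖∑ z ∈ F, z η‖ ≤ C * ‖∑ z ∈ F, z ξ‖ := by
      rw [← mul_pow] at h2
      exact le_of_sq_le_sq h2 (by positivity)
    have h4 : ‖∑ z ∈ F, z η‖ ≤ C * ‖ξ‖ :=
      h3.trans (mul_le_mul_of_nonneg_left (hcontr F hF ξ) hC)
    change ‖inner ℂ η w‖ ≤ C * ‖ξ‖ * ‖w‖
    rw [h1]
    exact (norm_inner_le_norm _ _).trans (mul_le_mul_of_nonneg_right h4 (norm_nonneg _))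
  have h5 := hbound η
  rw [inner_self_eq_norm_sq_to_K, norm_pow] at h5
  simp only [Complex.coe_algebraMap, Complex.norm_real, norm_norm] at h5
  rcases (norm_nonneg η).eq_or_lt with h | h
  · rw [← h]; positivity
  · nlinarith

theorem IsCentralExtensionElement.exists_cut {M : VonNeumannAlgebra H} {x : H →ₗ.[ℂ] H}
    (hx : M.IsCentralExtensionElement x) :
    ∃ e a : ℕ → H →L[ℂ] H, M.Exhaustion e ∧ (∀ n, a n ∈ M) ∧ ∀ n, Cut x (e n) (a n) := by
  obtain ⟨hL, Z, hZ, hO, hJ, hb⟩ := hx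
  have hd := hL.dense
  obtain ⟨-, haff, -⟩ := hL
  choose! a haM ha using hb
  have hcut : ∀ z ∈ Z, Cut x z (a z) := fun z hz => (strongMul_eq_ofBounded_iff hd).1 (ha z hz)
  let K : ℕ → Submodule ℂ H := fun n =>
    ⨅ z : {z : H →L[ℂ] H // z ∈ Z ∧ (n : ℝ) < ‖a z‖}, LinearMap.ker (z.1 : H →ₗ[ℂ] H)
  have hK : ∀ n ξ, ξ ∈ K n ↔ ∀ z ∈ Z, (n : ℝ) < ‖a z‖ → z ξ = 0 := by
    intro n ξ
    simp only [K, Submodule.mem_iInf, Subtype.forall, LinearMap.mem_ker, and_imp]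
    rfl
  have hKc : ∀ n, _root_.IsClosed (K n : Set H) := by
    intro n
    have : (K n : Set H) = ⋂ z : {z : H →L[ℂ] H // z ∈ Z ∧ (n : ℝ) < ‖a z‖}, {ξ | z.1 ξ = 0} := by
      ext ξ
      simp [hK]
    rw [this]
    exact isClosed_iInter fun z => isClosed_eq z.1.continuous continuous_const
  have hKcomp : ∀ n, CompleteSpace (K n) := fun n => (hKc n).completeSpace_coe
  have hKproj : ∀ n, (K n).HasOrthogonalProjection := fun n => inferInstance
  have hKmono : Monotone K := by
    intro m n hmn ξ hξ
    rw [hK] at hξ ⊢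
    intro z hz hlt
    exact hξ z hz (lt_of_le_of_lt (by exact_mod_cast hmn) hlt)
  have hzK : ∀ z ∈ Z, ∀ ξ, ∃ n, z ξ ∈ K n := by
    intro z hz ξ
    obtain ⟨n, hn⟩ := exists_nat_ge ‖a z‖
    refine ⟨n, (hK n _).2 fun w hw hlt => ?_⟩
    have hne : w ≠ z := by
      rintro rfl; exact absurd hlt (not_lt.2 hn)
    exact congrArg (fun q : H →L[ℂ] H => q ξ) (hO hw hz hne)
  have hdense : ⊤ ≤ (⨆ n, K n).topologicalClosure := by
    have h1 := dense_span_of_joinEqOne (fun z hz => (hZ z hz).1) hJ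
    have h2 : Submodule.span ℂ {ξ : H | ∃ p ∈ Z, p ξ = ξ} ≤ ⨆ n, K n := by
      rw [Submodule.span_le]
      rintro ξ ⟨p, hp, hpξ⟩
      obtain ⟨n, hn⟩ := hzK p hp ξ
      rw [hpξ] at hn
      exact (le_iSup K n) hn
    rw [← Submodule.dense_iff_topologicalClosure_eq_top.1 h1]
    exact Submodule.topologicalClosure_mono h2
  have hproj : ∀ n, M.center.IsProj (K n).starProjection := by
    intro n
    refine isProj_center_starProjection (K n) fun y hy ξ hξ => ?_
    rw [hK] at hξ ⊢
    intro z hz hlt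
    have h1 : z (y ξ) = y (z ξ) :=
      congrArg (fun q : H →L[ℂ] H => q ξ) (commute_of_mem_center (hZ z hz).2 hy)
    rw [h1, hξ z hz hlt, map_zero]
  have hmono : Monotone fun n => (K n).starProjection := by
    intro m n hmn
    refine ((hproj m).1.le_iff_mul_eq_right (hproj n).1).2 ?_
    ext ξ
    exact Submodule.starProjection_eq_self_iff.2
      (hKmono hmn ((K m).starProjection_apply_mem ξ))
  have hex : M.Exhaustion fun n => (K n).starProjection :=
    ⟨hproj, hmono, fun ξ => Submodule.starProjection_tendsto_self K hKmono ξ hdense⟩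
  have hbd : ∀ n (ξ : x.domain), ‖(K n).starProjection (x ξ)‖ ≤ n * ‖(ξ : H)‖ := by
    intro n ξ
    refine norm_le_of_orthogonal (fun z hz => (hZ z hz).1) hO hJ (Nat.cast_nonneg n) _ _ ?_
    intro z hz
    by_cases hlt : (n : ℝ) < ‖a z‖
    · rw [(hK n _).1 ((K n).starProjection_apply_mem _) z hz hlt, norm_zero]
      positivity
    · have h1 : z ((K n).starProjection (x ξ)) = (K n).starProjection (z (x ξ)) :=
        congrArg (fun q : H →L[ℂ] H => q (x ξ))
          (commute_of_mem_center (hZ z hz).2 (Or.inl (hproj n).2.1))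
      obtain ⟨hm, he⟩ := affiliated_central haff (hZ z hz) ξ
      have h2 : z (x ξ) = a z (z ξ) := by
        have := hcut z hz ⟨z ξ, hm⟩
        rw [he, starProjection_apply_apply (hZ z hz).1] at this
        exact this
      rw [h1, h2]
      refine (norm_starProjection_le (hproj n).1 _).trans (((a z).le_opNorm _).trans ?_)
      exact mul_le_mul_of_nonneg_right (not_lt.1 hlt) (norm_nonneg _)
  have hdr : DenseRange x.domain.subtype := hd.denseRange_val
  let f : ℕ → x.domain →ₗ[ℂ] H := fun n => ((K n).starProjection : H →ₗ[ℂ] H) ∘ₗ x.toFun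
  have hcutb : ∀ n, Cut x (K n).starProjection ((f n).extendOfNorm x.domain.subtype) := by
    intro n ξ
    exact (LinearMap.extendOfNorm_eq (f := f n) (e := x.domain.subtype) hdr
      ⟨n, fun ξ => hbd n ξ⟩ ξ).symm
  refine ⟨fun n => (K n).starProjection, fun n => (f n).extendOfNorm x.domain.subtype, hex,
    fun n => ?_, hcutb⟩
  set b := (f n).extendOfNorm x.domain.subtype with hbdef
  have hzb : ∀ z ∈ Z, z * b = (K n).starProjection * a z := by
    intro z hz
    have : (⇑(z * b) : H → H) = ⇑((K n).starProjection * a z) := by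
      refine Continuous.ext_on hd (z * b).continuous ((K n).starProjection * a z).continuous ?_
      intro ξ hξ
      change z (b ξ) = (K n).starProjection (a z ξ)
      have h1 := hcutb n ⟨ξ, hξ⟩
      have h2 := hcut z hz ⟨ξ, hξ⟩
      change _ = b ξ at h1
      rw [← h1, ← h2]
      exact congrArg (fun q : H →L[ℂ] H => q (x ⟨ξ, hξ⟩))
        (commute_of_mem_center (hZ z hz).2 (Or.inl (hproj n).2.1))
    exact DFunLike.coe_injective this
  rw [← commutant_commutant M, mem_commutant_iff]
  intro y hy
  ext ξ
  rw [← sub_eq_zero]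
  refine hJ _ fun z hz => ?_
  have h1 : z * (y * b) = z * (b * y) := by
    have hmem : (K n).starProjection * a z ∈ M := mul_mem (hproj n).2.1 (haM z hz)
    rw [← mul_assoc, commute_of_mem_center (hZ z hz).2 (Or.inr hy), mul_assoc, hzb z hz,
      ← mul_assoc z b y, hzb z hz]
    exact (mem_commutant_iff.1 hy _ hmem).symm
  rw [map_sub, sub_eq_zero]
  exact congrArg (fun q : H →L[ℂ] H => q ξ) h1

theorem isClosable_of_cut {M : VonNeumannAlgebra H} {x : H →ₗ.[ℂ] H} {e a : ℕ → H →L[ℂ] H}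
    (he : M.Exhaustion e) (hcut : ∀ n, Cut x (e n) (a n)) : x.IsClosable := by
  refine ⟨x.graph.topologicalClosure.toLinearPMap, ?_⟩
  rw [Submodule.toLinearPMap_graph_eq]
  intro p hp hp1
  refine he.eq_zero fun n => ?_
  have hcl : _root_.IsClosed {p : H × H | e n p.2 = a n p.1} :=
    isClosed_eq ((e n).continuous.comp continuous_snd) ((a n).continuous.comp continuous_fst)
  have h1 : _root_.closure (x.graph : Set (H × H)) ⊆ {p : H × H | e n p.2 = a n p.1} :=
    closure_minimal (fun p hp => cut_iff_graph.1 (hcut n) p hp) hcl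
  have h2 : e n p.2 = a n p.1 := h1 hp
  rw [h2, hp1, map_zero]

theorem isCentralExtensionElement_closure {M : VonNeumannAlgebra H} {x : H →ₗ.[ℂ] H}
    (ha : M.Affiliated x) (hd : Dense (x.domain : Set H))
    {e a : ℕ → H →L[ℂ] H} (he : M.Exhaustion e) (haM : ∀ n, a n ∈ M)
    (hcut : ∀ n, Cut x (e n) (a n)) : M.IsCentralExtensionElement x.closure :=
  isCentralExtensionElement_of_cut (isClosable_of_cut he hcut).closure_isClosed ha.closure
    (hd.mono x.le_closure.1) he haM fun n => (hcut n).closure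

theorem exists_common_cut {M : VonNeumannAlgebra H} {x y : H →ₗ.[ℂ] H}
    (hx : M.IsCentralExtensionElement x) (hy : M.IsCentralExtensionElement y) :
    ∃ g a b : ℕ → H →L[ℂ] H, M.Exhaustion g ∧ (∀ n, a n ∈ M) ∧ (∀ n, b n ∈ M) ∧
      (∀ n, Cut x (g n) (a n)) ∧ ∀ n, Cut y (g n) (b n) := by
  obtain ⟨e, a, he, haM, ha⟩ := hx.exists_cut
  obtain ⟨f, b, hf, hbM, hb⟩ := hy.exists_cut
  refine ⟨fun n => e n * f n, fun n => f n * a n, fun n => e n * b n, he.mul hf,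
    fun n => mul_mem (hf.proj n).2.1 (haM n), fun n => mul_mem (he.proj n).2.1 (hbM n),
    fun n => ?_, fun n => (hb n).mul _⟩
  have h := (ha n).mul (f n)
  rw [commute_of_mem_center (hf.proj n).2 (Or.inl (he.proj n).2.1)] at h
  exact h

theorem exists_common_cut₃ {M : VonNeumannAlgebra H} {x y z : H →ₗ.[ℂ] H}
    (hx : M.IsCentralExtensionElement x) (hy : M.IsCentralExtensionElement y)
    (hz : M.IsCentralExtensionElement z) :
    ∃ g a b c : ℕ → H →L[ℂ] H, M.Exhaustion g ∧
      (∀ n, Cut x (g n) (a n)) ∧ (∀ n, Cut y (g n) (b n)) ∧ ∀ n, Cut z (g n) (c n) := by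
  obtain ⟨e, a, b, he, -, -, ha, hb⟩ := exists_common_cut hx hy
  obtain ⟨f, c, hf, -, hc⟩ := hz.exists_cut
  have hcomm : ∀ n, f n * e n = e n * f n := fun n =>
    commute_of_mem_center (hf.proj n).2 (Or.inl (he.proj n).2.1)
  refine ⟨fun n => e n * f n, fun n => f n * a n, fun n => f n * b n, fun n => e n * c n,
    he.mul hf, fun n => ?_, fun n => ?_, fun n => (hc n).mul _⟩
  · have h := (ha n).mul (f n); rw [hcomm] at h; exact h
  · have h := (hb n).mul (f n); rw [hcomm] at h; exact h

theorem IsCentralExtensionElement.eq_of_cut {M : VonNeumannAlgebra H} {x y : H →ₗ.[ℂ] H}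
    (hx : M.IsCentralExtensionElement x) (hy : M.IsCentralExtensionElement y)
    {e a b : ℕ → H →L[ℂ] H} (he : M.Exhaustion e) (ha : ∀ n, Cut x (e n) (a n))
    (hb : ∀ n, Cut y (e n) (b n)) (hab : ∀ n, a n = b n) : x = y := by
  obtain rfl : a = b := funext hab
  exact VonNeumannAlgebra.eq_of_cut hx.1.1 hx.1.2.1 hx.1.dense hy.1.1 hy.1.2.1 hy.1.dense he ha hb

theorem IsCentralExtensionElement.strongAdd {M : VonNeumannAlgebra H} {x y : H →ₗ.[ℂ] H}
    (hx : M.IsCentralExtensionElement x) (hy : M.IsCentralExtensionElement y) :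
    M.IsCentralExtensionElement (strongAdd x y) := by
  obtain ⟨g, a, b, hg, haM, hbM, ha, hb⟩ := exists_common_cut hx hy
  have hgD : ∀ n ξ, g n ξ ∈ (x + y).domain := by
    intro n ξ
    -- it suffices to see that `g n ξ` belongs to the domain of every element cut down by `g`
    have key : ∀ {w : H →ₗ.[ℂ] H} {c : ℕ → H →L[ℂ] H}, M.IsCentralExtensionElement w →
        (∀ n, Cut w (g n) (c n)) → g n ξ ∈ w.domain := by
      intro w c hw hc
      have hcl : _root_.IsClosed {ξ : H | (g n ξ, c n ξ) ∈ w.graph} :=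
        IsClosed.preimage (f := fun ξ : H => (g n ξ, c n ξ)) (by fun_prop) hw.1.1
      have hmem : (g n ξ, c n ξ) ∈ w.graph := by
        refine (hcl.closure_subset_iff (s := (w.domain : Set H))).2 ?_ (hw.1.dense ξ)
        intro ζ hζ
        obtain ⟨h1, h2⟩ := affiliated_central hw.1.2.1 (hg.proj n) ⟨ζ, hζ⟩
        have h3 := w.mem_graph ⟨_, h1⟩
        rw [h2, hc n] at h3
        exact h3
      exact LinearPMap.mem_domain_of_mem_graph hmem
    exact ⟨key hx ha, key hy hb⟩
  have hd : Dense ((x + y).domain : Set H) := fun ξ =>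
    mem_closure_of_tendsto (hg.tendsto ξ) (Filter.Eventually.of_forall fun n => hgD n ξ)
  have haff : M.Affiliated (x + y) := by
    intro w hw hw' ξ
    obtain ⟨h1, e1⟩ := hx.1.2.1 w hw hw' ⟨ξ, ξ.2.1⟩
    obtain ⟨h2, e2⟩ := hy.1.2.1 w hw hw' ⟨ξ, ξ.2.2⟩
    refine ⟨⟨h1, h2⟩, ?_⟩
    rw [LinearPMap.add_apply, LinearPMap.add_apply, map_add]
    exact congrArg₂ (· + ·) e1 e2
  refine isCentralExtensionElement_closure haff hd hg (fun n => add_mem (haM n) (hbM n)) ?_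
  intro n ξ
  rw [LinearPMap.add_apply, map_add, ha, hb]; rfl

theorem smul_mem_alg {M : VonNeumannAlgebra H} {a : H →L[ℂ] H} (c : ℂ) (ha : a ∈ M) : c • a ∈ M :=
  M.toStarSubalgebra.smul_mem ha c

theorem IsCentralExtensionElement.strongSMul {M : VonNeumannAlgebra H} {x : H →ₗ.[ℂ] H}
    (hx : M.IsCentralExtensionElement x) (c : ℂ) :
    M.IsCentralExtensionElement (strongSMul c x) := by
  obtain ⟨g, a, hg, haM, ha⟩ := hx.exists_cut
  have haff : M.Affiliated (c • x) := by
    intro w hw hw' ξ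
    obtain ⟨h1, e1⟩ := hx.1.2.1 w hw hw' ξ
    refine ⟨h1, ?_⟩
    rw [LinearPMap.smul_apply, LinearPMap.smul_apply, map_smul]
    exact congrArg (c • ·) e1
  refine isCentralExtensionElement_closure haff hx.1.dense hg (fun n => smul_mem_alg c (haM n)) ?_
  intro n ξ
  rw [LinearPMap.smul_apply, map_smul]
  exact congrArg (c • ·) (ha n ξ)

theorem exhaustion_one (M : VonNeumannAlgebra H) : M.Exhaustion fun _ => 1 :=
  ⟨fun _ => ⟨.one _, one_mem _⟩, monotone_const, fun _ => tendsto_const_nhds⟩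

theorem isCentralExtensionElement_ofBounded {M : VonNeumannAlgebra H} {a : H →L[ℂ] H}
    (ha : a ∈ M) : M.IsCentralExtensionElement (ofBounded a) :=
  isCentralExtensionElement_of_cut (ofBounded_isClosed a) (ofBounded_isMeasurable ha).2.1
    dense_univ M.exhaustion_one (fun _ => ha) fun _ _ => rfl

theorem cut_zero (g : H →L[ℂ] H) : Cut (ofBounded (0 : H →L[ℂ] H)) g 0 := fun _ => map_zero g

namespace CentralExtension

variable {M : VonNeumannAlgebra H}

instance : Zero M.CentralExtension :=
  ⟨⟨ofBounded 0, isCentralExtensionElement_ofBounded (zero_mem M)⟩⟩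

/-- Addition in `E(M)` is the strong sum. -/
instance : Add M.CentralExtension := ⟨fun x y => ⟨strongAdd x.1 y.1, x.2.strongAdd y.2⟩⟩

instance : SMul ℂ M.CentralExtension := ⟨fun c x => ⟨strongSMul c x.1, x.2.strongSMul c⟩⟩

instance : Neg M.CentralExtension := ⟨fun x => (-1 : ℂ) • x⟩

instance : AddCommGroup M.CentralExtension where
  add_assoc x y z := by
    obtain ⟨g, a, b, c, hg, ha, hb, hc⟩ := exists_common_cut₃ x.2 y.2 z.2
    exact Subtype.ext <| (x + y + z).2.eq_of_cut (x + (y + z)).2 hg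
      (fun n => ((ha n).add (hb n)).add (hc n)) (fun n => (ha n).add ((hb n).add (hc n)))
      fun n => add_assoc _ _ _
  zero_add x := by
    obtain ⟨g, a, hg, -, ha⟩ := x.2.exists_cut
    exact Subtype.ext <| (0 + x).2.eq_of_cut x.2 hg (fun n => (cut_zero (g n)).add (ha n)) ha
      fun n => zero_add _
  add_zero x := by
    obtain ⟨g, a, hg, -, ha⟩ := x.2.exists_cut
    exact Subtype.ext <| (x + 0).2.eq_of_cut x.2 hg (fun n => (ha n).add (cut_zero (g n))) ha
      fun n => add_zero _
  nsmul := nsmulRec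
  zsmul := zsmulRec
  neg_add_cancel x := by
    obtain ⟨g, a, hg, -, ha⟩ := x.2.exists_cut
    exact Subtype.ext <| (-x + x).2.eq_of_cut (0 : M.CentralExtension).2 hg
      (fun n => ((ha n).smul (-1)).add (ha n)) (fun n => cut_zero (g n)) fun n => by simp
  add_comm x y := by
    obtain ⟨g, a, b, hg, -, -, ha, hb⟩ := exists_common_cut x.2 y.2
    exact Subtype.ext <| (x + y).2.eq_of_cut (y + x).2 hg
      (fun n => (ha n).add (hb n)) (fun n => (hb n).add (ha n)) fun n => add_comm _ _

instance : Module ℂ M.CentralExtension where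
  one_smul x := by
    obtain ⟨g, a, hg, -, ha⟩ := x.2.exists_cut
    exact Subtype.ext <| ((1 : ℂ) • x).2.eq_of_cut x.2 hg (fun n => (ha n).smul 1) ha
      fun n => one_smul _ _
  mul_smul c d x := by
    obtain ⟨g, a, hg, -, ha⟩ := x.2.exists_cut
    exact Subtype.ext <| ((c * d) • x).2.eq_of_cut (c • d • x).2 hg (fun n => (ha n).smul _)
      (fun n => ((ha n).smul d).smul c) fun n => mul_smul _ _ _
  smul_zero c :=
    Subtype.ext <| (c • (0 : M.CentralExtension)).2.eq_of_cut (0 : M.CentralExtension).2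
      M.exhaustion_one (fun _ => (cut_zero _).smul c) (fun _ => cut_zero _) fun _ => smul_zero _
  smul_add c x y := by
    obtain ⟨g, a, b, hg, -, -, ha, hb⟩ := exists_common_cut x.2 y.2
    exact Subtype.ext <| (c • (x + y)).2.eq_of_cut (c • x + c • y).2 hg
      (fun n => ((ha n).add (hb n)).smul c) (fun n => ((ha n).smul c).add ((hb n).smul c))
      fun n => smul_add _ _ _
  add_smul c d x := by
    obtain ⟨g, a, hg, -, ha⟩ := x.2.exists_cut
    exact Subtype.ext <| ((c + d) • x).2.eq_of_cut (c • x + d • x).2 hg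
      (fun n => (ha n).smul (c + d)) (fun n => ((ha n).smul c).add ((ha n).smul d))
      fun n => add_smul _ _ _
  zero_smul x := by
    obtain ⟨g, a, hg, -, ha⟩ := x.2.exists_cut
    exact Subtype.ext <| ((0 : ℂ) • x).2.eq_of_cut (0 : M.CentralExtension).2 hg
      (fun n => (ha n).smul 0) (fun n => cut_zero (g n)) fun n => zero_smul _ _

end CentralExtension

/-! ### The center-valued norm -/

/-- A positive unbounded operator: self-adjoint (in particular densely defined and closed) with
nonnegative quadratic form. -/
def IsPositiveOp (x : H →ₗ.[ℂ] H) : Prop :=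
  IsSelfAdjoint x ∧ ∀ ξ : x.domain, 0 ≤ (inner ℂ (x ξ) (ξ : H)).re

/-- The order of locally measurable self-adjoint operators: the strong difference `y - x` is
positive. -/
def OpLE (x y : H →ₗ.[ℂ] H) : Prop := IsPositiveOp (strongSub y x)

/-- `a = |x| = (x* x)^{1/2}`: `a` is positive and `a a = x* x`, where both products carry their
natural domains. -/
def IsAbs (x a : H →ₗ.[ℂ] H) : Prop :=
  IsPositiveOp a ∧ ∀ ξ η : H,
    (∃ ζ, (ξ, ζ) ∈ a.graph ∧ (ζ, η) ∈ a.graph) ↔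
      ∃ ζ, (ξ, ζ) ∈ x.graph ∧ (ζ, η) ∈ x.adjoint.graph

/-- The self-adjoint elements of `S(Z(M))`. -/
def IsCentralSelfAdjoint (M : VonNeumannAlgebra H) (f : H →ₗ.[ℂ] H) : Prop :=
  M.center.IsMeasurable f ∧ IsSelfAdjoint f

/-- `f` is a self-adjoint element of `S(Z(M))` with `|x| ≤ f`. -/
def IsCentralMajorant (M : VonNeumannAlgebra H) (x f : H →ₗ.[ℂ] H) : Prop :=
  M.IsCentralSelfAdjoint f ∧ ∃ a, IsAbs x a ∧ OpLE a f

/-- `f = ‖x‖ = inf {g ∈ S(Z(M)) : |x| ≤ g}`, the infimum being taken in the ordered set of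
self-adjoint elements of `S(Z(M))`. -/
def IsCenterNorm (M : VonNeumannAlgebra H) (x f : H →ₗ.[ℂ] H) : Prop :=
  M.IsCentralSelfAdjoint f ∧ (∀ g, M.IsCentralMajorant x g → OpLE f g) ∧
    ∀ h, M.IsCentralSelfAdjoint h → (∀ g, M.IsCentralMajorant x g → OpLE h g) → OpLE h f

/-! ### The topology `t_c(M)` -/

/-- The direct sum property of a measure: there is a family of measurable sets of positive finite
measure such that every measurable set of finite measure is, up to a null set, covered by countably
many of them; and the family exhausts the space, that is, a measurable set which meets every member
of the family in a null set is itself null. -/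
def HasDirectSumProperty {Ω : Type v} [MeasurableSpace Ω] (μ : Measure Ω) : Prop :=
  ∃ 𝒥 : Set (Set Ω), (∀ S ∈ 𝒥, MeasurableSet S ∧ 0 < μ S ∧ μ S < ∞) ∧
    (∀ A, MeasurableSet A → μ A < ∞ → ∃ 𝒥₀ ⊆ 𝒥, 𝒥₀.Countable ∧ μ (A \ ⋃₀ 𝒥₀) = 0) ∧
    ∀ N, MeasurableSet N → (∀ S ∈ 𝒥, μ (N ∩ S) = 0) → μ N = 0

/-- An identification `Z(M) ≡ L^∞(Ω, Σ, μ)`: a measure space whose measure has the direct sum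
property, and a *-isomorphism of the center of `M` onto its algebra `L^∞`. -/
structure CenterModel (M : VonNeumannAlgebra H) where
  /-- the underlying set -/
  Ω : Type v
  /-- the σ-algebra `Σ` -/
  [measurableSpace : MeasurableSpace Ω]
  /-- the measure -/
  μ : Measure Ω
  directSum : HasDirectSumProperty μ
  /-- the *-isomorphism of `Z(M)` onto `L^∞` -/
  iso : M.center.toStarSubalgebra ≃ₗ[ℂ] Lp ℂ ∞ μ
  map_mul : ∀ a b, ((iso (a * b) : Lp ℂ ∞ μ) : Ω →ₘ[μ] ℂ) = (iso a : Ω →ₘ[μ] ℂ) * iso b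
  map_star : ∀ a, iso (star a) = star (iso a)

attribute [instance] CenterModel.measurableSpace

namespace CenterModel

variable {M : VonNeumannAlgebra H}

/-- The central projection corresponding to the characteristic function of a set of finite
measure. -/
def chi (R : CenterModel.{u, v} M) {B : Set R.Ω} (hB : MeasurableSet B) (hμ : R.μ B ≠ ∞) :
    H →L[ℂ] H :=
  (R.iso.symm (indicatorConstLp ∞ hB hμ 1) : M.center.toStarSubalgebra)

/-- `W(A, ε, δ)`, as a set of elements of `S(Z(M))`: there is a measurable `B ⊆ A` with
`μ (A \ B) ≤ δ` such that `f χ_B` belongs to `Z(M) ≡ L^∞` and has norm at most `ε`. -/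
def W (R : CenterModel.{u, v} M) (A : Set R.Ω) (ε δ : ℝ) : Set (H →ₗ.[ℂ] H) :=
  {f | M.center.IsMeasurable f ∧
    ∃ (B : Set R.Ω) (hB : MeasurableSet B) (hμ : R.μ B ≠ ∞), B ⊆ A ∧
      R.μ (A \ B) ≤ ENNReal.ofReal δ ∧
      ∃ a ∈ M.center, strongMul (R.chi hB hμ) f = ofBounded a ∧ ‖a‖ ≤ ε}

/-- `O(A, ε, δ) = {x ∈ E(M) : ‖x‖ ∈ W(A, ε, δ)}`. -/
def O (R : CenterModel.{u, v} M) (A : Set R.Ω) (ε δ : ℝ) : Set M.CentralExtension :=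
  {x | ∃ f, M.IsCenterNorm x.1 f ∧ f ∈ R.W A ε δ}

/-- The topology `t_c(M)` on `E(M)`: the sets `x + O(A, ε, δ)` with `ε, δ > 0`, `A` measurable and
`μ A < ∞` are a base of neighbourhoods of `x`. -/
@[reducible] def tc (R : CenterModel.{u, v} M) : TopologicalSpace M.CentralExtension :=
  TopologicalSpace.mkOfNhds fun x =>
    ⨅ (A : Set R.Ω) (ε : ℝ) (δ : ℝ) (_ : MeasurableSet A ∧ R.μ A < ∞ ∧ 0 < ε ∧ 0 < δ),
      Filter.principal ((fun o => x + o) '' R.O A ε δ)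

end CenterModel

/-- A topology `τ` on the complex vector space `E` is normable: `(E, τ)` is linearly homeomorphic
to a normed space, equivalently `τ` is the topology of a norm on `E`. -/
def IsNormable {E : Type u} [AddCommGroup E] [Module ℂ E] (τ : TopologicalSpace E) : Prop :=
  ∃ (F : Type u) (_ : NormedAddCommGroup F) (_ : NormedSpace ℂ F), Nonempty (E ≃L[ℂ] F)

/-! ### Finite direct sums of factors -/

/-- A factor: a von Neumann algebra on a nonzero Hilbert space with center `ℂ 1`. -/
def IsFactor (M : VonNeumannAlgebra H) : Prop :=
  Nontrivial H ∧ ∀ z ∈ M.center, ∃ c : ℂ, z = c • (1 : H →L[ℂ] H)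

/-- `M` is (*-isomorphic to) a direct sum of finitely many factors. -/
def IsFiniteSumOfFactors (M : VonNeumannAlgebra H) : Prop :=
  ∃ (n : ℕ) (K : Fin n → Type u) (_ : ∀ j, NormedAddCommGroup (K j))
    (_ : ∀ j, InnerProductSpace ℂ (K j)) (_ : ∀ j, CompleteSpace (K j))
    (N : ∀ j, VonNeumannAlgebra (K j)),
    (∀ j, (N j).IsFactor) ∧
      Nonempty (M.toStarSubalgebra ≃⋆ₐ[ℂ] ∀ j, (N j).toStarSubalgebra)

end

end VonNeumannAlgebra

namespace VonNeumannAlgebra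

set_option linter.unusedSectionVars false

variable {H : Type u} [NormedAddCommGroup H] [InnerProductSpace ℂ H] [CompleteSpace H]

/-! ### Everywhere defined operators -/

/-! Both normability and the decomposition into factors are compared with a third condition: the
center is spanned by finitely many nonzero, mutually orthogonal projections `z j` with sum `1`
(`IsCenterBasis`).

Normability makes the center finite-dimensional because a norm ball contains no nonzero line, while
neighbourhoods of `0` in `t_c(M)` tend to contain many. The center-valued norm of `c χ_C` is `|c|
χ_C`, which vanishes on `A \ C`; so if `μ (A ∩ C) ≤ δ`, the whole line `ℂ χ_C` lies in `O(A, ε, δ)`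
(`smulChi_mem_O`). Pulling back the unit ball therefore gives `A` of finite measure and `δ > 0` such
that every `C` of finite measure with `μ (A ∩ C) ≤ δ` is null. By the direct sum property the
complement of `A` is null, and since subsets of `A` of measure at most `δ` are null, `A` is up to a
null set a finite union of atoms (`exists_atoms_of_le_nsmul`). Measurable functions are constant on
atoms, so the characteristic functions of the atoms span the center.

Conversely, over a finite-dimensional center an increasing sequence of central projections with join
`1` reaches `1`. Hence `S(Z(M)) = Z(M)` and `E(M) = M`, the center-valued norm of `b` is `∑ j, ‖b
z_j‖ z_j`, and its operator norm is `‖b‖`. Sets of finite measure take finitely many measures, so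
for a suitable `A` and a small `δ` only conull `B` satisfy `μ (A \ B) ≤ δ`; then `O(A, ε, δ)` is the
closed ball of radius `ε`, and `t_c(M)` is the norm topology (`tc_eq_induced`).

The link with factors is algebraic. A basis of the center splits `M` into the reduced algebras `M
z_j`, which are factors; a *-isomorphism onto a finite sum of factors pulls the units of the
summands back to such a basis. The existential form of the theorem also needs one identification to
exist, and counting measure on the index set supplies it. -/

theorem mem_graph_ofBounded {a : H →L[ℂ] H} {ξ η : H} :
    (ξ, η) ∈ (ofBounded a).graph ↔ a ξ = η := by
  rw [LinearPMap.mem_graph_iff]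
  constructor
  · rintro ⟨y, rfl, rfl⟩
    rfl
  · intro h
    exact ⟨⟨ξ, trivial⟩, rfl, h⟩

theorem ofBounded_injective : Function.Injective (ofBounded : (H →L[ℂ] H) → H →ₗ.[ℂ] H) := by
  intro a b h
  ext ξ
  exact (mem_graph_ofBounded.1 (h ▸ mem_graph_ofBounded.2 rfl)).symm

theorem eq_ofBounded_of_graph {x : H →ₗ.[ℂ] H} {a : H →L[ℂ] H}
    (h : ∀ ξ η, (ξ, η) ∈ x.graph ↔ a ξ = η) : x = ofBounded a := by
  refine LinearPMap.eq_of_eq_graph ?_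
  ext ⟨ξ, η⟩
  rw [h, mem_graph_ofBounded]

/-- The closed graph theorem. -/
theorem exists_eq_ofBounded_of_domain_eq_top {x : H →ₗ.[ℂ] H} (hc : x.IsClosed)
    (hx : x.domain = ⊤) : ∃ a : H →L[ℂ] H, x = ofBounded a := by
  have hD : ∀ ξ : H, ξ ∈ x.domain := fun ξ => hx ▸ trivial
  let T : H →ₗ[ℂ] H := x.toFun ∘ₗ LinearMap.codRestrict x.domain LinearMap.id hD
  have hg : ∀ ξ η, (ξ, η) ∈ x.graph ↔ T ξ = η := by
    intro ξ η
    rw [LinearPMap.mem_graph_iff]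
    constructor
    · rintro ⟨y, rfl, rfl⟩
      rfl
    · intro h
      exact ⟨⟨ξ, hD ξ⟩, rfl, h⟩
  have hgr : (T.graph : Set (H × H)) = x.graph := by
    ext ⟨ξ, η⟩
    rw [SetLike.mem_coe, SetLike.mem_coe, hg, LinearMap.mem_graph_iff]
    exact eq_comm
  have hT : Continuous T := T.continuous_of_isClosed_graph (by rw [hgr]; exact hc)
  exact ⟨⟨T, hT⟩, eq_ofBounded_of_graph hg⟩

theorem closure_ofBounded (a : H →L[ℂ] H) : (ofBounded a).closure = ofBounded a := by
  refine LinearPMap.eq_of_eq_graph ?_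
  rw [← (ofBounded_isClosed a).isClosable.graph_closure_eq_closure_graph]
  exact IsClosed.submodule_topologicalClosure_eq (ofBounded_isClosed a)

theorem strongSub_ofBounded (a b : H →L[ℂ] H) :
    strongSub (ofBounded a) (ofBounded b) = ofBounded (a - b) := by
  have : ofBounded a - ofBounded b = ofBounded (a - b) := by
    refine LinearPMap.ext ?_ ?_
    · rw [LinearPMap.sub_domain]; exact inf_idem _
    · intro ξ h1 h2
      rw [LinearPMap.sub_apply]; rfl
  rw [strongSub, this, closure_ofBounded]

theorem strongAdd_ofBounded (a b : H →L[ℂ] H) :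
    strongAdd (ofBounded a) (ofBounded b) = ofBounded (a + b) := by
  have : ofBounded a + ofBounded b = ofBounded (a + b) := by
    refine LinearPMap.ext ?_ ?_
    · rw [LinearPMap.add_domain]; exact inf_idem _
    · intro ξ h1 h2
      rw [LinearPMap.add_apply]; rfl
  rw [strongAdd, this, closure_ofBounded]

theorem strongSMul_ofBounded (c : ℂ) (a : H →L[ℂ] H) :
    strongSMul c (ofBounded a) = ofBounded (c • a) := by
  have : c • ofBounded a = ofBounded (c • a) := by
    refine LinearPMap.ext rfl ?_
    intro ξ h1 h2
    rw [LinearPMap.smul_apply]; rfl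
  rw [strongSMul, this, closure_ofBounded]

theorem strongMul_ofBounded_eq_iff {z b a : H →L[ℂ] H} :
    strongMul z (ofBounded b) = ofBounded a ↔ z * b = a := by
  rw [strongMul_eq_ofBounded_iff dense_univ]
  constructor
  · intro h
    ext ξ
    exact h ⟨ξ, trivial⟩
  · rintro rfl ξ
    rfl

theorem adjoint_ofBounded (a : H →L[ℂ] H) : (ofBounded a).adjoint = ofBounded (star a) :=
  a.toPMap_adjoint_eq_adjoint_toPMap_of_dense dense_univ

theorem isSelfAdjoint_ofBounded_iff {a : H →L[ℂ] H} :
    IsSelfAdjoint (ofBounded a) ↔ IsSelfAdjoint a := by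
  rw [LinearPMap.isSelfAdjoint_def, adjoint_ofBounded, ofBounded_injective.eq_iff]
  rfl

theorem isPositiveOp_ofBounded_iff {a : H →L[ℂ] H} : IsPositiveOp (ofBounded a) ↔ 0 ≤ a := by
  rw [IsPositiveOp, isSelfAdjoint_ofBounded_iff, ContinuousLinearMap.nonneg_iff_isPositive,
    ContinuousLinearMap.isPositive_def, ContinuousLinearMap.isSelfAdjoint_iff_isSymmetric]
  exact and_congr_right fun _ => ⟨fun h ξ => h ⟨ξ, trivial⟩, fun h ξ => h ξ⟩

theorem opLE_ofBounded_iff {a b : H →L[ℂ] H} : OpLE (ofBounded a) (ofBounded b) ↔ a ≤ b := by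
  rw [OpLE, strongSub_ofBounded, isPositiveOp_ofBounded_iff, sub_nonneg]

/-- Since `b* b` is everywhere defined, `a a = b* b` with natural domains forces `a` to be
everywhere defined. A self-adjoint operator is closed, so `a` is bounded, and positive square roots
are unique. -/
theorem isAbs_ofBounded_iff {b : H →L[ℂ] H} {a : H →ₗ.[ℂ] H} :
    IsAbs (ofBounded b) a ↔ a = ofBounded (CFC.abs b) := by
  have hb : ∀ ξ η, (∃ ζ, (ξ, ζ) ∈ (ofBounded b).graph ∧ (ζ, η) ∈ (ofBounded b).adjoint.graph) ↔
      (star b * b) ξ = η := by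
    intro ξ η
    simp only [adjoint_ofBounded, mem_graph_ofBounded]
    constructor
    · rintro ⟨_, rfl, rfl⟩
      rfl
    · intro h
      exact ⟨_, rfl, h⟩
  constructor
  · rintro ⟨hpos, h⟩
    simp only [hb] at h
    obtain ⟨a', rfl⟩ := exists_eq_ofBounded_of_domain_eq_top hpos.1.isClosed <| by
      rw [eq_top_iff]
      intro ξ _
      obtain ⟨ζ, h1, -⟩ := (h ξ _).2 rfl
      exact LinearPMap.mem_domain_of_mem_graph h1
    have h0 := isPositiveOp_ofBounded_iff.1 hpos
    have hsq : a' * a' = star b * b := by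
      ext ξ
      exact ((h ξ _).1 ⟨a' ξ, mem_graph_ofBounded.2 rfl, mem_graph_ofBounded.2 rfl⟩).symm
    rw [CFC.abs, CFC.sqrt_unique hsq h0]
  · rintro rfl
    refine ⟨isPositiveOp_ofBounded_iff.2 (CFC.abs_nonneg b), fun ξ η => ?_⟩
    rw [hb, ← CFC.abs_mul_abs]
    simp only [mem_graph_ofBounded]
    constructor
    · rintro ⟨_, rfl, rfl⟩
      rfl
    · intro h
      exact ⟨_, rfl, h⟩

/-! ### Bounded central elements and membership in the algebra -/

theorem isCentralSelfAdjoint_ofBounded {M : VonNeumannAlgebra H} {a : H →L[ℂ] H}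
    (ha : a ∈ M.center) (hs : IsSelfAdjoint a) : M.IsCentralSelfAdjoint (ofBounded a) :=
  ⟨ofBounded_isMeasurable ha, isSelfAdjoint_ofBounded_iff.2 hs⟩

/-- If `|b|` is central, then it is the center-valued norm of `b`. -/
theorem isCenterNorm_of_abs_mem_center {M : VonNeumannAlgebra H} {b : H →L[ℂ] H}
    (hb : CFC.abs b ∈ M.center) : M.IsCenterNorm (ofBounded b) (ofBounded (CFC.abs b)) := by
  have hc := isCentralSelfAdjoint_ofBounded hb (CFC.abs_nonneg b).isSelfAdjoint
  refine ⟨hc, ?_, fun h _ hle => hle _ ⟨hc, _, isAbs_ofBounded_iff.2 rfl,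
    opLE_ofBounded_iff.2 le_rfl⟩⟩
  rintro g ⟨-, a, ha, hle⟩
  rwa [isAbs_ofBounded_iff.1 ha] at hle

theorem abs_smul_starProjection {p : H →L[ℂ] H} (hp : IsStarProjection p) (c : ℂ) :
    CFC.abs (c • p) = (‖c‖ : ℂ) • p := by
  rw [CFC.abs_smul, CFC.abs_of_nonneg p hp.nonneg]
  exact (Complex.coe_smul ‖c‖ p).symm

/-- A von Neumann algebra is norm closed. -/
theorem isClosed_coe (M : VonNeumannAlgebra H) :
    IsClosed (M.toStarSubalgebra : Set (H →L[ℂ] H)) := by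
  rw [coe_toStarSubalgebra, ← M.centralizer_centralizer]
  exact Set.isClosed_centralizer _

/-- An operator commuting with all unitaries of the commutant belongs to the algebra. -/
theorem mem_of_affiliated {M : VonNeumannAlgebra H} {a : H →L[ℂ] H}
    (ha : M.Affiliated (ofBounded a)) : a ∈ M := by
  rw [← commutant_commutant M, mem_commutant_iff]
  intro y hy
  -- Norm closedness makes the commutant a C*-algebra, in which every element is a linear
  -- combination of four unitaries; commuting with unitaries is therefore enough.
  have := M.commutant.isClosed_coe
  obtain ⟨w, c, h, -⟩ :=
    CStarAlgebra.exists_sum_four_unitary (⟨y, hy⟩ : M.commutant.toStarSubalgebra)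
  have hy' : y = ∑ i, c i • ((w i : M.commutant.toStarSubalgebra) : H →L[ℂ] H) := by
    have := congrArg (Subtype.val) h
    simpa using this
  rw [hy', Finset.sum_mul, Finset.mul_sum]
  refine Finset.sum_congr rfl fun i _ => ?_
  rw [smul_mul_assoc, mul_smul_comm]
  congr 1
  ext ξ
  have hu : ((w i : M.commutant.toStarSubalgebra) : H →L[ℂ] H) ∈ unitary (H →L[ℂ] H) := by
    have := (w i).2
    rw [Unitary.mem_iff] at this ⊢
    exact ⟨congrArg Subtype.val this.1, congrArg Subtype.val this.2⟩
  obtain ⟨_, e⟩ := ha _ hu (w i : M.commutant.toStarSubalgebra).2 ⟨ξ, trivial⟩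
  exact e.symm

/-! ### Reduction of a von Neumann algebra by a central projection -/

section Reduced

variable (K : Submodule ℂ H) [CompleteSpace K]

/-- The extension by zero of an operator on a closed subspace. -/
noncomputable def dilate (T : K →L[ℂ] K) : H →L[ℂ] H := K.subtypeL ∘L T ∘L K.orthogonalProjectionOnto

/-- The compression of an operator to a closed subspace. -/
noncomputable def compress (a : H →L[ℂ] H) : K →L[ℂ] K := K.orthogonalProjectionOnto ∘L a ∘L K.subtypeL

variable {K}

theorem dilate_apply (T : K →L[ℂ] K) (ξ : H) :
    dilate K T ξ = T (K.orthogonalProjectionOnto ξ) := rfl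

theorem coe_compress_apply (a : H →L[ℂ] H) (ξ : K) :
    (compress K a ξ : H) = K.starProjection (a ξ) := rfl

theorem dilate_mul (S T : K →L[ℂ] K) : dilate K (S * T) = dilate K S * dilate K T := by
  ext ξ
  simp [dilate_apply]

theorem dilate_add (S T : K →L[ℂ] K) : dilate K (S + T) = dilate K S + dilate K T := by
  ext ξ
  simp [dilate_apply]

theorem dilate_zero : dilate K (0 : K →L[ℂ] K) = 0 := by
  ext ξ
  simp [dilate_apply]

theorem dilate_smul (c : ℂ) (T : K →L[ℂ] K) : dilate K (c • T) = c • dilate K T := by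
  ext ξ
  simp [dilate_apply]

theorem dilate_one : dilate K (1 : K →L[ℂ] K) = K.starProjection := by
  ext ξ
  rfl

theorem dilate_star (T : K →L[ℂ] K) : dilate K (star T) = star (dilate K T) := by
  simp only [dilate, ContinuousLinearMap.star_eq_adjoint, ContinuousLinearMap.adjoint_comp,
    Submodule.adjoint_subtypeL, Submodule.adjoint_orthogonalProjectionOnto]
  rfl

theorem compress_star (a : H →L[ℂ] H) : compress K (star a) = star (compress K a) := by
  simp only [compress, ContinuousLinearMap.star_eq_adjoint, ContinuousLinearMap.adjoint_comp,
    Submodule.adjoint_subtypeL, Submodule.adjoint_orthogonalProjectionOnto]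
  rfl

theorem dilate_compress (a : H →L[ℂ] H) :
    dilate K (compress K a) = K.starProjection * a * K.starProjection := by
  ext ξ
  rfl

theorem compress_dilate (T : K →L[ℂ] K) : compress K (dilate K T) = T := by
  ext ξ
  simp [coe_compress_apply, dilate_apply]

theorem dilate_injective : Function.Injective (dilate K) :=
  Function.LeftInverse.injective compress_dilate

theorem starProjection_mul_dilate (T : K →L[ℂ] K) : K.starProjection * dilate K T = dilate K T := by
  rw [← dilate_one, ← dilate_mul, one_mul]

theorem dilate_mul_starProjection (T : K →L[ℂ] K) : dilate K T * K.starProjection = dilate K T := by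
  rw [← dilate_one, ← dilate_mul, mul_one]

theorem dilate_compress_of_commute {a : H →L[ℂ] H}
    (ha : K.starProjection * a = a * K.starProjection) :
    dilate K (compress K a) = a * K.starProjection := by
  rw [dilate_compress, ha, mul_assoc, ← dilate_one, ← dilate_mul, one_mul]

/-- Compression is not multiplicative in general. For operators commuting with the projection `P`
onto `K`, the injective multiplicative map `dilate K` sends the compression of `a` to `a P`, and the
identity can be checked there. -/
theorem compress_mul_of_commute {a b : H →L[ℂ] H}
    (ha : K.starProjection * a = a * K.starProjection)
    (hb : K.starProjection * b = b * K.starProjection) :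
    compress K (a * b) = compress K a * compress K b := by
  have hab : K.starProjection * (a * b) = a * b * K.starProjection := by
    rw [← mul_assoc, ha, mul_assoc, hb, mul_assoc]
  apply dilate_injective
  rw [dilate_mul, dilate_compress_of_commute hab, dilate_compress_of_commute ha,
    dilate_compress_of_commute hb, ← hb, mul_assoc a K.starProjection,
    ← mul_assoc K.starProjection, ← dilate_one, ← dilate_mul, one_mul, dilate_one, hb, mul_assoc]

/-- If `T` commutes with the compression of `y`, and `y` commutes with the projection onto `K`, then
the extension of `T` by zero commutes with `y`. -/
theorem dilate_commute {y : H →L[ℂ] H} {T : K →L[ℂ] K}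
    (hy : K.starProjection * y = y * K.starProjection)
    (h : compress K y * T = T * compress K y) : y * dilate K T = dilate K T * y := by
  rw [← starProjection_mul_dilate, ← mul_assoc, ← dilate_compress_of_commute hy, ← dilate_mul, h,
    dilate_mul, dilate_compress_of_commute hy, ← hy, ← mul_assoc, dilate_mul_starProjection,
    starProjection_mul_dilate]

theorem compress_commute {y : H →L[ℂ] H} {T : K →L[ℂ] K}
    (hy : K.starProjection * y = y * K.starProjection)
    (h : y * dilate K T = dilate K T * y) : compress K y * T = T * compress K y := by
  apply dilate_injective
  rw [dilate_mul, dilate_mul, dilate_compress_of_commute hy, mul_assoc, starProjection_mul_dilate,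
    h, ← hy, ← mul_assoc, dilate_mul_starProjection]

/-- The reduction of `M` by the central projection onto the closed subspace `K`. -/
noncomputable def reduced (M : VonNeumannAlgebra H) (hK : K.starProjection ∈ M.center) :
    VonNeumannAlgebra K where
  carrier := {T | dilate K T ∈ M}
  mul_mem' {S T} hS hT := by
    change dilate K (S * T) ∈ M
    rw [dilate_mul]; exact mul_mem hS hT
  one_mem' := by
    change dilate K 1 ∈ M
    rw [dilate_one]; exact hK.1
  add_mem' {S T} hS hT := by
    change dilate K (S + T) ∈ M
    rw [dilate_add]; exact add_mem hS hT
  zero_mem' := by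
    change dilate K 0 ∈ M
    rw [dilate_zero]; exact zero_mem M
  algebraMap_mem' c := by
    change dilate K (algebraMap ℂ _ c) ∈ M
    rw [Algebra.algebraMap_eq_smul_one, dilate_smul, dilate_one]
    exact smul_mem_alg c hK.1
  star_mem' {T} hT := by
    change dilate K (star T) ∈ M
    rw [dilate_star]; exact star_mem hT
  centralizer_centralizer' := by
    apply Set.Subset.antisymm _ Set.subset_centralizer_centralizer
    intro T hT
    change dilate K T ∈ M
    rw [← commutant_commutant M, mem_commutant_iff]
    intro y hy
    have hc := commute_of_mem_center hK (Or.inr hy)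
    -- The compression of `y ∈ M'` commutes with the whole reduced algebra, hence with `T`, which
    -- lies in its bicommutant.
    refine dilate_commute hc (hT _ fun S hS => ?_)
    exact (compress_commute hc (mem_commutant_iff.1 hy _ hS).symm).symm

theorem mem_reduced {M : VonNeumannAlgebra H} {hK : K.starProjection ∈ M.center}
    {T : K →L[ℂ] K} : T ∈ M.reduced hK ↔ dilate K T ∈ M := Iff.rfl

theorem compress_mem_reduced {M : VonNeumannAlgebra H} (hK : K.starProjection ∈ M.center)
    {a : H →L[ℂ] H} (ha : a ∈ M) : compress K a ∈ M.reduced hK := by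
  rw [mem_reduced, dilate_compress]
  exact mul_mem (mul_mem hK.1 ha) hK.1

/-- Elements of `M` compress into the reduced algebra, so they commute with the extension of `T`.
This is what lets information on the center of `M` pass to the reduced algebras. -/
theorem dilate_mem_center {M : VonNeumannAlgebra H} {hK : K.starProjection ∈ M.center}
    {T : K →L[ℂ] K} (hT : T ∈ (M.reduced hK).center) : dilate K T ∈ M.center := by
  refine ⟨hT.1, mem_commutant_iff.2 fun a ha => ?_⟩
  exact dilate_commute (commute_of_mem_center hK (Or.inl ha))
    (mem_commutant_iff.1 hT.2 _ (compress_mem_reduced hK ha))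

end Reduced

/-! ### Finite-dimensional centers -/

/-- The family `z` consists of the minimal projections of the center of `M`, and the center is
their linear span. -/
structure IsCenterBasis (M : VonNeumannAlgebra H) {ι : Type} [Fintype ι]
    (z : ι → H →L[ℂ] H) : Prop where
  proj : ∀ j, M.center.IsProj (z j)
  ne_zero : ∀ j, z j ≠ 0
  orthogonal : ∀ i j, i ≠ j → z i * z j = 0
  sum_eq_one : ∑ j, z j = 1
  span : ∀ c ∈ M.center, ∃ k : ι → ℂ, c = ∑ j, k j • z j

namespace IsCenterBasis

variable {M : VonNeumannAlgebra H} {ι κ : Type} [Fintype ι] [Fintype κ] {z : ι → H →L[ℂ] H}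

theorem reindex (hz : M.IsCenterBasis z) (e : κ ≃ ι) : M.IsCenterBasis (z ∘ e) where
  proj j := hz.proj _
  ne_zero j := hz.ne_zero _
  orthogonal i j h := hz.orthogonal _ _ (e.injective.ne h)
  sum_eq_one := (e.sum_comp z).trans hz.sum_eq_one
  span c hc := by
    obtain ⟨k, rfl⟩ := hz.span c hc
    exact ⟨k ∘ e, (e.sum_comp fun j => k j • z j).symm⟩

theorem mul_self (hz : M.IsCenterBasis z) (j : ι) : z j * z j = z j :=
  (hz.proj j).1.isIdempotentElem.eq

theorem sum_smul_mul (hz : M.IsCenterBasis z) (k : ι → ℂ) (i : ι) :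
    (∑ j, k j • z j) * z i = k i • z i := by
  rw [Finset.sum_mul, Finset.sum_eq_single i, smul_mul_assoc, hz.mul_self]
  · intro j _ hj
    rw [smul_mul_assoc, hz.orthogonal j i hj, smul_zero]
  · simp

theorem sum_smul_mem (hz : M.IsCenterBasis z) (k : ι → ℂ) : ∑ j, k j • z j ∈ M.center :=
  sum_mem fun j _ => smul_mem_alg (k j) (hz.proj j).2

/-- Multiplication by `z i` isolates the `i`-th coefficient, and `z i ≠ 0`. -/
theorem coeff_injective (hz : M.IsCenterBasis z) :
    Function.Injective fun k : ι → ℂ => ∑ j, k j • z j := by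
  intro k l h
  funext i
  have h1 := congrArg (· * z i) h
  simp only [hz.sum_smul_mul] at h1
  exact smul_left_injective ℂ (hz.ne_zero i) h1

/-- The summands are the reductions of `M` to the ranges of the `z j`. Sending `a` to its
compressions is an isomorphism with inverse the sum of the extensions by zero, because `a = ∑ j, a
z_j`. -/
theorem isFiniteSumOfFactors (hz : M.IsCenterBasis z) : M.IsFiniteSumOfFactors := by
  obtain ⟨n, z, hz⟩ : ∃ (n : ℕ) (z : Fin n → H →L[ℂ] H), M.IsCenterBasis z :=
    ⟨_, _, hz.reindex (Fintype.equivFin ι).symm⟩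
  have hK : ∀ j, ∃ K : Submodule ℂ H, ∃ _ : CompleteSpace K, z j = K.starProjection := by
    intro j
    have hp := (hz.proj j).1
    have hcl : IsClosed ((z j).range : Set H) := ContinuousLinearMap.IsIdempotentElem.isClosed_range hp.isIdempotentElem
    have hcs : CompleteSpace (z j).range := hcl.completeSpace_coe
    obtain ⟨_, h⟩ := isStarProjection_iff_eq_starProjection_range.1 hp
    exact ⟨(z j).range, hcs, h⟩
  choose K hC hzK using hK
  have hcen : ∀ j, (K j).starProjection ∈ M.center := fun j => hzK j ▸ (hz.proj j).2
  obtain ⟨N, hN⟩ : ∃ N : ∀ j, VonNeumannAlgebra (K j), ∀ j, N j = M.reduced (hcen j) :=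
    ⟨_, fun _ => rfl⟩
  have hmem : ∀ {j T}, T ∈ N j ↔ dilate (K j) T ∈ M := fun {j T} => by rw [hN, mem_reduced]
  refine ⟨n, fun j => K j, fun j => inferInstance, fun j => inferInstance, hC, N, fun j => ⟨?_, ?_⟩, ?_⟩
  · by_contra hn
    have := not_nontrivial_iff_subsingleton.1 hn
    refine hz.ne_zero j ?_
    rw [hzK j, ← dilate_one, Subsingleton.elim (1 : K j →L[ℂ] K j) 0, dilate_zero]
  · intro T hT
    rw [hN] at hT
    obtain ⟨k, hk⟩ := hz.span _ (dilate_mem_center hT)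
    refine ⟨k j, dilate_injective ?_⟩
    -- The extension of a central `T` is a combination of all the `z i` that is unchanged by
    -- multiplication by `z j`; only the multiple of `z j` survives, so `T` is scalar.
    rw [← dilate_mul_starProjection, hk, ← hzK j, hz.sum_smul_mul, dilate_smul, dilate_one, hzK j]
  · have hcomm : ∀ j, ∀ a ∈ M, (K j).starProjection * a = a * (K j).starProjection :=
      fun j a ha => commute_of_mem_center (hcen j) (Or.inl ha)
    have hd : ∀ a ∈ M, ∀ j, dilate (K j) (compress (K j) a) = a * z j := fun a ha j => by
      rw [hzK]; exact dilate_compress_of_commute (hcomm j a ha)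
    exact ⟨{
      toFun := fun a j => ⟨compress (K j) a, (hN j).symm ▸ compress_mem_reduced (hcen j) a.2⟩
      invFun := fun T => ⟨∑ j, dilate (K j) (T j).1, sum_mem fun j _ => hmem.1 (T j).2⟩
      left_inv := fun a => by
        refine Subtype.ext ?_
        change ∑ j, dilate (K j) (compress (K j) a.1) = a.1
        rw [Finset.sum_congr rfl fun j _ => hd a.1 a.2 j, ← Finset.mul_sum, hz.sum_eq_one, mul_one]
      right_inv := fun T => by
        funext i
        refine Subtype.ext (dilate_injective ?_)
        change dilate (K i) (compress (K i) (∑ j, dilate (K j) (T j).1)) = _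
        rw [hd _ (sum_mem fun j _ => hmem.1 (T j).2), Finset.sum_mul, Finset.sum_eq_single i]
        · rw [hzK, dilate_mul_starProjection]
        · intro j _ hj
          rw [← dilate_mul_starProjection, ← hzK, mul_assoc, hz.orthogonal j i hj, mul_zero]
        · simp
      map_mul' := fun a b => by
        funext j
        exact Subtype.ext (compress_mul_of_commute (hcomm j a a.2) (hcomm j b b.2))
      map_add' := fun a b => by
        funext j
        refine Subtype.ext ?_
        ext ξ
        change (K j).starProjection (a.1 ξ + b.1 ξ) = (K j).starProjection (a.1 ξ) +
          (K j).starProjection (b.1 ξ)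
        exact map_add _ _ _
      map_star' := fun a => by
        funext j
        exact Subtype.ext (compress_star _)
      map_smul' := fun c a => by
        funext j
        refine Subtype.ext ?_
        ext ξ
        change (K j).starProjection (c • a.1 ξ) = c • (K j).starProjection (a.1 ξ)
        exact map_smul _ _ _ }⟩

end IsCenterBasis

/-- In an algebra isomorphic to a finite product of algebras with trivial center, the center is
spanned by nonzero pairwise orthogonal self-adjoint idempotents. -/
theorem exists_central_idempotents {n : ℕ} {A : Type*} [Ring A] [StarRing A] [Algebra ℂ A]
    {B : Fin n → Type*} [∀ j, Ring (B j)] [∀ j, StarRing (B j)] [∀ j, Algebra ℂ (B j)]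
    [∀ j, Nontrivial (B j)]
    (hB : ∀ j, ∀ b : B j, (∀ t, t * b = b * t) → ∃ k : ℂ, b = k • (1 : B j))
    (φ : A ≃⋆ₐ[ℂ] ∀ j, B j) :
    ∃ z : Fin n → A, (∀ j, IsStarProjection (z j)) ∧ (∀ j a, a * z j = z j * a) ∧
      (∀ j, z j ≠ 0) ∧ (∀ i j, i ≠ j → z i * z j = 0) ∧ ∑ j, z j = 1 ∧
      ∀ c : A, (∀ a, a * c = c * a) → ∃ k : Fin n → ℂ, c = ∑ j, k j • z j := by
  let z : Fin n → A := fun j => φ.symm (Pi.single j 1)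
  have hφz : ∀ j, φ (z j) = Pi.single j 1 := fun j => φ.apply_symm_apply _
  have hinj := EquivLike.injective φ
  refine ⟨z, fun j => ⟨hinj ?_, hinj ?_⟩, fun j a => hinj ?_, fun j h0 => ?_,
    fun i j hij => hinj ?_, hinj ?_, fun c hc => ?_⟩
  · rw [map_mul, hφz, ← Pi.single_mul, one_mul]
  · rw [map_star, hφz]
    funext i
    by_cases hi : i = j
    · subst hi; simp
    · simp [hi]
  · rw [map_mul, map_mul, hφz]
    funext i
    by_cases hi : i = j
    · subst hi; simp
    · simp [hi]
  · have h2 := congrFun (hφz j) j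
    rw [h0, map_zero, Pi.single_eq_same] at h2
    exact zero_ne_one h2
  · rw [map_mul, hφz, hφz, map_zero]
    funext l
    by_cases hl : l = i
    · subst hl; simp [hij]
    · simp [hl]
  · rw [map_sum, map_one, Finset.sum_congr rfl fun j _ => hφz j]
    exact Finset.univ_sum_single (fun _ => 1)
  -- Commutation of `c` with the preimage of an element supported at `j` shows that the `j`-th
  -- coordinate of `φ c` is central in `B j`.
  · have hk : ∀ j, ∃ k : ℂ, φ c j = k • 1 := by
      intro j
      refine hB j _ fun t => ?_
      have h2 := congrFun (congrArg φ (hc (φ.symm (Pi.single j t)))) j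
      rwa [map_mul, map_mul, φ.apply_symm_apply, Pi.mul_apply, Pi.mul_apply,
        Pi.single_eq_same] at h2
    choose k hk using hk
    refine ⟨k, hinj ?_⟩
    have hterm : ∀ j, φ (k j • z j) = k j • Pi.single j 1 := fun j => by rw [map_smul, hφz]
    rw [map_sum, Finset.sum_congr rfl fun j _ => hterm j]
    funext i
    rw [Finset.sum_apply, Finset.sum_eq_single i, hk]
    · simp
    · intro j _ hj
      simp [hj.symm]
    · simp

/-- The basis consists of the preimages of the units of the summands. The argument is purely
algebraic, so no continuity of the isomorphism enters; for `n = 0` the family is empty and `1 = 0`.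
-/
theorem IsFiniteSumOfFactors.exists_isCenterBasis {M : VonNeumannAlgebra H}
    (h : M.IsFiniteSumOfFactors) :
    ∃ (n : ℕ) (z : Fin n → H →L[ℂ] H), M.IsCenterBasis z := by
  obtain ⟨n, K, _, _, _, N, hN, ⟨φ⟩⟩ := h
  have hnt : ∀ j, Nontrivial (N j).toStarSubalgebra := by
    intro j
    have := (hN j).1
    exact ⟨0, 1, fun h => zero_ne_one (congrArg Subtype.val h)⟩
  obtain ⟨z, hp, hc, h0, ho, hs, hspan⟩ := exists_central_idempotents (fun j b hb => by
    obtain ⟨k, hk⟩ := (hN j).2 b.1 ⟨b.2, mem_commutant_iff.2 fun t ht =>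
      congrArg Subtype.val (hb ⟨t, ht⟩)⟩
    exact ⟨k, Subtype.ext hk⟩) φ
  refine ⟨n, fun j => z j, ⟨fun j => ⟨⟨?_, ?_⟩, (z j).2, mem_commutant_iff.2 fun a ha => ?_⟩,
    fun j h => h0 j (Subtype.ext h), fun i j hij => congrArg Subtype.val (ho i j hij), ?_,
    fun c hcc => ?_⟩⟩
  · exact congrArg Subtype.val (hp j).isIdempotentElem.eq
  · exact congrArg Subtype.val (hp j).isSelfAdjoint.star_eq
  · exact congrArg Subtype.val (hc j ⟨a, ha⟩)
  · simpa using congrArg Subtype.val hs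
  · obtain ⟨k, hk⟩ := hspan ⟨c, hcc.1⟩ fun a =>
      Subtype.ext (mem_commutant_iff.1 hcc.2 a.1 a.2)
    exact ⟨k, by simpa using congrArg Subtype.val hk⟩

/-! ### Atoms -/

/-- If small measurable sets are null, then a set of finite measure is a finite union of atoms. -/
theorem exists_atoms_of_le_nsmul {Ω : Type v} [MeasurableSpace Ω] {μ : Measure Ω} {d : ℝ≥0∞}
    (hd : d ≠ ∞) (h : ∀ C, MeasurableSet C → μ C ≤ d → μ C = 0) (N : ℕ) :
    ∀ C, MeasurableSet C → μ C ≤ N * d → ∃ (ι : Type) (_ : Fintype ι) (D : ι → Set Ω),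
      (∀ i, MeasurableSet (D i)) ∧ (∀ i, μ (D i) ≠ 0) ∧ (∀ i, D i ⊆ C) ∧
      (∀ i j, i ≠ j → Disjoint (D i) (D j)) ∧ μ (C \ ⋃ i, D i) = 0 ∧
      ∀ i S, MeasurableSet S → μ (D i ∩ S) = 0 ∨ μ (D i \ S) = 0 := by
  have hnull : ∀ C, μ C = 0 → ∃ (ι : Type) (_ : Fintype ι) (D : ι → Set Ω),
      (∀ i, MeasurableSet (D i)) ∧ (∀ i, μ (D i) ≠ 0) ∧ (∀ i, D i ⊆ C) ∧
      (∀ i j, i ≠ j → Disjoint (D i) (D j)) ∧ μ (C \ ⋃ i, D i) = 0 ∧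
      ∀ i S, MeasurableSet S → μ (D i ∩ S) = 0 ∨ μ (D i \ S) = 0 := fun C hC =>
    ⟨Empty, inferInstance, Empty.elim, fun i => i.elim, fun i => i.elim, fun i => i.elim,
      fun i => i.elim, measure_mono_null Set.sdiff_subset hC, fun i => i.elim⟩
  induction N with
  | zero =>
    intro C _ hC
    exact hnull C (by simpa using hC)
  | succ N ih =>
    intro C hCm hC
    by_cases h0 : μ C = 0
    · exact hnull C h0
    -- Either `C` is itself an atom, or it splits into two non-null pieces, to which the induction
    -- hypothesis applies.
    by_cases hat : ∀ S, MeasurableSet S → μ (C ∩ S) = 0 ∨ μ (C \ S) = 0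
    · exact ⟨Unit, inferInstance, fun _ => C, fun _ => hCm, fun _ => h0, fun _ => subset_rfl,
        fun i j hij => absurd rfl hij, by simp [Set.iUnion_const], fun _ => hat⟩
    push Not at hat
    obtain ⟨S, hS, h1, h2⟩ := hat
    have hm1 := hCm.inter hS
    have hm2 := hCm.diff hS
    have hsum := measure_inter_add_sdiff (μ := μ) C hS
    have hd1 : d ≤ μ (C ∩ S) := le_of_lt (not_le.1 fun hle => h1 (h _ hm1 hle))
    have hd2 : d ≤ μ (C \ S) := le_of_lt (not_le.1 fun hle => h2 (h _ hm2 hle))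
    have hN : ((N + 1 : ℕ) : ℝ≥0∞) * d = N * d + d := by push_cast; ring
    rw [hN, ← hsum] at hC
    -- A non-null piece has measure at least `d`, so the other piece has measure at most `N * d`.
    -- Cancelling `d` is legitimate because it is finite.
    obtain ⟨ι, _, D, hD1, hD2, hD3, hD4, hD5, hD6⟩ := ih _ hm1 <|
      (ENNReal.add_le_add_iff_right hd).1 ((add_le_add_right hd2 _).trans hC)
    obtain ⟨κ, _, D', hD1', hD2', hD3', hD4', hD5', hD6'⟩ := ih _ hm2 <|
      (ENNReal.add_le_add_iff_right hd).1
        ((add_le_add_right hd1 _).trans (by rwa [add_comm (μ (C \ S))]))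
    have hdisj : ∀ i j, Disjoint (D i) (D' j) := fun i j =>
      (Set.disjoint_left.2 fun x hx hx' => hx'.2 hx.2 :
        Disjoint (C ∩ S) (C \ S)).mono (hD3 i) (hD3' j)
    refine ⟨ι ⊕ κ, inferInstance, Sum.elim D D', ?_, ?_, ?_, ?_, ?_, ?_⟩
    · rintro (i | i)
      exacts [hD1 i, hD1' i]
    · rintro (i | i)
      exacts [hD2 i, hD2' i]
    · rintro (i | i)
      exacts [(hD3 i).trans Set.inter_subset_left, (hD3' i).trans Set.sdiff_subset]
    · rintro (i | i) (j | j) hij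
      exacts [hD4 i j fun h => hij (h ▸ rfl), hdisj i j, (hdisj j i).symm,
        hD4' i j fun h => hij (h ▸ rfl)]
    · refine measure_mono_null ?_ (measure_union_null hD5 hD5')
      rintro x ⟨hx, hxD⟩
      rw [Set.iUnion_sum, Set.mem_union, not_or] at hxD
      by_cases hxS : x ∈ S
      exacts [Or.inl ⟨⟨hx, hxS⟩, hxD.1⟩, Or.inr ⟨⟨hx, hxS⟩, hxD.2⟩]
    · rintro (i | i)
      exacts [hD6 i, hD6' i]

/-- A measurable function is almost everywhere constant on an atom. -/
theorem exists_ae_eq_const_of_atom {Ω : Type v} [MeasurableSpace Ω] {μ : Measure Ω} {D : Set Ω}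
    (hD : MeasurableSet D)
    (h : ∀ S, MeasurableSet S → μ (D ∩ S) = 0 ∨ μ (D \ S) = 0) {f : Ω → ℂ} (hf : Measurable f) :
    ∃ k : ℂ, ∀ᵐ x ∂μ, x ∈ D → f x = k := by
  -- On an atom the preimage of each measurable subset of `ℂ` is null or conull. Countably many
  -- measurable sets separate the points of `ℂ`, so these alternatives single out one value.
  obtain ⟨k, hk⟩ := Filter.exists_eventuallyEq_const_of_forall_separating (l := ae (μ.restrict D))
    (f := f) MeasurableSet fun U hU => by
      rw [ae_restrict_iff' hD, ae_restrict_iff' hD]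
      rcases h _ (hf hU) with h0 | h0
      · right
        filter_upwards [measure_eq_zero_iff_ae_notMem.1 h0] with x hx hxD hxU
        exact hx ⟨hxD, hxU⟩
      · left
        filter_upwards [measure_eq_zero_iff_ae_notMem.1 h0] with x hx hxD
        by_contra hxU
        exact hx ⟨hxD, hxU⟩
  exact ⟨k, (ae_restrict_iff' hD).1 hk⟩

/-! ### The projections of a model of the center -/

namespace CenterModel

variable {M : VonNeumannAlgebra H} (R : CenterModel.{u, v} M)

/-- Used throughout to verify identities in the center pointwise almost everywhere. -/
theorem eq_of_ae_eq {s t : M.center.toStarSubalgebra} (h : R.iso s =ᵐ[R.μ] R.iso t) : s = t :=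
  R.iso.injective (Lp.ext h)

theorem coeFn_iso_mul (s t : M.center.toStarSubalgebra) :
    R.iso (s * t) =ᵐ[R.μ] fun x => R.iso s x * R.iso t x := by
  have h := AEEqFun.coeFn_mul (R.iso s : R.Ω →ₘ[R.μ] ℂ) (R.iso t)
  rw [← R.map_mul] at h
  exact h

variable {B C : Set R.Ω}

/-- The projection `χ_B` as an element of the center. -/
noncomputable def chiElem (hB : MeasurableSet B) (hμ : R.μ B ≠ ∞) : M.center.toStarSubalgebra :=
  R.iso.symm (indicatorConstLp ∞ hB hμ 1)

theorem coeFn_iso_chiElem (hB : MeasurableSet B) (hμ : R.μ B ≠ ∞) :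
    R.iso (R.chiElem hB hμ) =ᵐ[R.μ] B.indicator fun _ => 1 := by
  rw [chiElem, LinearEquiv.apply_symm_apply]
  exact indicatorConstLp_coeFn

theorem coeFn_iso_mul_chiElem (s : M.center.toStarSubalgebra) (hB : MeasurableSet B)
    (hμ : R.μ B ≠ ∞) : R.iso (s * R.chiElem hB hμ) =ᵐ[R.μ] B.indicator (R.iso s) := by
  filter_upwards [R.coeFn_iso_mul s (R.chiElem hB hμ), R.coeFn_iso_chiElem hB hμ] with x h1 h2
  rw [h1, h2]
  by_cases hx : x ∈ B <;> simp [hx]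

theorem chiElem_mul (hB : MeasurableSet B) (hμ : R.μ B ≠ ∞) (hC : MeasurableSet C)
    (hμC : R.μ C ≠ ∞) (hμi : R.μ (B ∩ C) ≠ ∞) :
    R.chiElem hB hμ * R.chiElem hC hμC = R.chiElem (hB.inter hC) hμi := by
  refine R.eq_of_ae_eq ?_
  filter_upwards [R.coeFn_iso_mul_chiElem (R.chiElem hB hμ) hC hμC, R.coeFn_iso_chiElem hB hμ,
    R.coeFn_iso_chiElem (hB.inter hC) hμi] with x h1 h2 h3
  rw [h1, h3]
  by_cases hx : x ∈ C
  · rw [Set.indicator_of_mem hx, h2]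
    by_cases hx' : x ∈ B <;> simp [hx, hx']
  · simp [hx]

theorem chi_eq_coe (hB : MeasurableSet B) (hμ : R.μ B ≠ ∞) :
    R.chi hB hμ = (R.chiElem hB hμ : H →L[ℂ] H) := rfl

theorem chi_eq_iff (hB : MeasurableSet B) (hμ : R.μ B ≠ ∞) (hC : MeasurableSet C)
    (hμC : R.μ C ≠ ∞) : R.chi hB hμ = R.chi hC hμC ↔ B =ᵐ[R.μ] C := by
  rw [chi_eq_coe, chi_eq_coe, Subtype.coe_inj, chiElem, chiElem, R.iso.symm.injective.eq_iff,
    indicatorConstLp_inj hB hμ hC hμC one_ne_zero]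

theorem chi_empty : R.chi MeasurableSet.empty (by simp) = 0 := by
  rw [chi, indicatorConstLp_empty, map_zero]
  rfl

theorem chi_eq_zero_iff (hB : MeasurableSet B) (hμ : R.μ B ≠ ∞) :
    R.chi hB hμ = 0 ↔ R.μ B = 0 := by
  rw [← R.chi_empty, chi_eq_iff, ae_eq_empty]

theorem chi_mul_eq_zero (hB : MeasurableSet B) (hμ : R.μ B ≠ ∞) (hC : MeasurableSet C)
    (hμC : R.μ C ≠ ∞) (h : Disjoint B C) : R.chi hB hμ * R.chi hC hμC = 0 := by
  have hi : B ∩ C = ∅ := h.inter_eq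
  have h0 : R.μ (B ∩ C) ≠ ∞ := by simp [hi]
  have h1 := congrArg Subtype.val (R.chiElem_mul hB hμ hC hμC h0)
  refine h1.trans ?_
  rw [← chi_eq_coe, chi_eq_zero_iff, hi, measure_empty]

theorem chi_isProj (hB : MeasurableSet B) (hμ : R.μ B ≠ ∞) : M.center.IsProj (R.chi hB hμ) := by
  refine ⟨⟨?_, ?_⟩, (R.chiElem hB hμ).2⟩
  · have h0 : R.μ (B ∩ B) ≠ ∞ := by rwa [Set.inter_self]
    have h1 := congrArg Subtype.val (R.chiElem_mul hB hμ hB hμ h0)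
    refine h1.trans ?_
    rw [← chi_eq_coe, chi_eq_iff, Set.inter_self]
    exact Filter.EventuallyEq.rfl
  · have : star (R.chiElem hB hμ) = R.chiElem hB hμ := by
      refine R.eq_of_ae_eq ?_
      rw [R.map_star]
      filter_upwards [Lp.coeFn_star (R.iso (R.chiElem hB hμ)), R.coeFn_iso_chiElem hB hμ]
        with x h1 h2
      rw [h1, Pi.star_apply, h2]
      by_cases hx : x ∈ B <;> simp [hx]
    exact congrArg Subtype.val this

theorem chi_eq_one (hB : MeasurableSet B) (hμ : R.μ B ≠ ∞) (h : R.μ Bᶜ = 0) :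
    R.chi hB hμ = 1 := by
  have : 1 * R.chiElem hB hμ = 1 := by
    refine R.eq_of_ae_eq ?_
    filter_upwards [R.coeFn_iso_mul_chiElem 1 hB hμ, measure_eq_zero_iff_ae_notMem.1 h]
      with x h1 h2
    rw [h1, Set.indicator_of_mem (not_not.1 h2)]
  rw [one_mul] at this
  exact congrArg Subtype.val this

/-- Atoms of finite measure covering the space give a basis of the center. -/
theorem isCenterBasis_of_atoms {ι : Type} [Fintype ι] {D : ι → Set R.Ω}
    (hD : ∀ i, MeasurableSet (D i)) (hf : ∀ i, R.μ (D i) ≠ ∞) (h0 : ∀ i, R.μ (D i) ≠ 0)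
    (hdisj : ∀ i j, i ≠ j → Disjoint (D i) (D j)) (hcov : R.μ (⋃ i, D i)ᶜ = 0)
    (hat : ∀ i S, MeasurableSet S → R.μ (D i ∩ S) = 0 ∨ R.μ (D i \ S) = 0) :
    M.IsCenterBasis fun i => R.chi (hD i) (hf i) := by
  have horth : ∀ i j, i ≠ j → R.chi (hD i) (hf i) * R.chi (hD j) (hf j) = 0 :=
    fun i j hij => R.chi_mul_eq_zero _ _ _ _ (hdisj i j hij)
  have hidem : ∀ i, R.chi (hD i) (hf i) * R.chi (hD i) (hf i) = R.chi (hD i) (hf i) :=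
    fun i => (R.chi_isProj (hD i) (hf i)).1.isIdempotentElem.eq
  have hsum : ∑ i, R.chi (hD i) (hf i) = 1 := by
    -- The defect `t` is annihilated by each `χ_{D i}`, so its function vanishes on every `D i`. The
    -- `D i` cover the space up to a null set, whence `t = 0`.
    let t : M.center.toStarSubalgebra := 1 - ∑ i, R.chiElem (hD i) (hf i)
    have hcoe : (t : H →L[ℂ] H) = 1 - ∑ i, R.chi (hD i) (hf i) := by
      simp [t, chi_eq_coe]
    have ht : ∀ i, t * R.chiElem (hD i) (hf i) = 0 := by
      intro i
      refine Subtype.ext ?_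
      change (t : H →L[ℂ] H) * R.chi (hD i) (hf i) = 0
      rw [hcoe, sub_mul, one_mul, Finset.sum_mul, Finset.sum_eq_single i, hidem, sub_self]
      · intro j _ hj
        exact horth j i hj
      · simp
    have h1 : ∀ᵐ x ∂(R.μ), ∀ i, (D i).indicator (R.iso t) x = 0 := by
      rw [ae_all_iff]
      intro i
      have h2 := R.coeFn_iso_mul_chiElem t (hD i) (hf i)
      rw [ht, map_zero] at h2
      filter_upwards [h2, Lp.coeFn_zero ℂ ∞ R.μ] with x h3 h4
      rw [← h3, h4]; rfl
    have ht0 : t = 0 := by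
      refine R.eq_of_ae_eq ?_
      rw [map_zero]
      filter_upwards [h1, Lp.coeFn_zero ℂ ∞ R.μ, measure_eq_zero_iff_ae_notMem.1 hcov]
        with x h2 h3 h4
      rw [h3]
      obtain ⟨i, hi⟩ := Set.mem_iUnion.1 (not_not.1 h4)
      have := h2 i
      rwa [Set.indicator_of_mem hi] at this
    rw [ht0] at hcoe
    exact (sub_eq_zero.1 hcoe.symm).symm
  refine ⟨fun i => R.chi_isProj _ _, fun i h => h0 i ((R.chi_eq_zero_iff _ _).1 h), horth, hsum,
    fun c hc => ?_⟩
  let s : M.center.toStarSubalgebra := ⟨c, hc⟩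
  -- The coefficients of a central element are the constant values of its function on the atoms.
  choose k hk using fun i =>
    exists_ae_eq_const_of_atom (hD i) (hat i) (Lp.stronglyMeasurable (R.iso s)).measurable
  refine ⟨k, ?_⟩
  rw [← mul_one c, ← hsum, Finset.mul_sum]
  refine Finset.sum_congr rfl fun i _ => ?_
  have : s * R.chiElem (hD i) (hf i) = k i • R.chiElem (hD i) (hf i) := by
    refine R.eq_of_ae_eq ?_
    rw [map_smul]
    filter_upwards [R.coeFn_iso_mul_chiElem s (hD i) (hf i), hk i,
      Lp.coeFn_smul (k i) (R.iso (R.chiElem (hD i) (hf i))), R.coeFn_iso_chiElem (hD i) (hf i)]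
      with x h1 h2 h3 h4
    rw [h1, h3, Pi.smul_apply, h4]
    by_cases hx : x ∈ D i
    · simp [hx, h2 hx]
    · simp [hx]
  exact congrArg Subtype.val this

/-! ### Normability forces a finite-dimensional center -/

/-- The element `c χ_C` of `E(M)`. -/
noncomputable def smulChi (hC : MeasurableSet C) (hμ : R.μ C ≠ ∞) (c : ℂ) : M.CentralExtension :=
  ⟨ofBounded (c • R.chi hC hμ),
    isCentralExtensionElement_ofBounded (smul_mem_alg c (R.chi_isProj hC hμ).2.1)⟩

theorem smulChi_eq (hC : MeasurableSet C) (hμ : R.μ C ≠ ∞) (c : ℂ) :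
    R.smulChi hC hμ c = c • R.smulChi hC hμ 1 := by
  refine Subtype.ext ?_
  change _ = strongSMul c (ofBounded _)
  rw [strongSMul_ofBounded, one_smul]
  rfl

/-- The center-valued norm `|c| χ_C` vanishes on `B = A \ C`, and the removed set `A ∩ C` has
measure at most `δ`. Hence neither `c` nor `ε` is restricted, and `O(A, ε, δ)` contains a whole
line. -/
theorem smulChi_mem_O {A : Set R.Ω} {ε δ : ℝ} (hA : MeasurableSet A) (hμA : R.μ A ≠ ∞)
    (hε : 0 ≤ ε) (hC : MeasurableSet C) (hμ : R.μ C ≠ ∞)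
    (h : R.μ (A ∩ C) ≤ ENNReal.ofReal δ) (c : ℂ) : R.smulChi hC hμ c ∈ R.O A ε δ := by
  have hp := R.chi_isProj hC hμ
  have habs := abs_smul_starProjection hp.1 c
  have hcen : (‖c‖ : ℂ) • R.chi hC hμ ∈ M.center := smul_mem_alg _ hp.2
  refine ⟨ofBounded ((‖c‖ : ℂ) • R.chi hC hμ), ?_, ofBounded_isMeasurable hcen, A \ C,
    hA.diff hC, measure_ne_top_of_subset Set.sdiff_subset hμA, Set.sdiff_subset, ?_, 0,
    zero_mem _, ?_, by simpa using hε⟩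
  · rw [← habs]
    exact isCenterNorm_of_abs_mem_center (habs ▸ hcen)
  · rwa [Set.sdiff_sdiff_right_self]
  · rw [strongMul_ofBounded_eq_iff, mul_smul_comm, chi_mul_eq_zero, smul_zero]
    exact Set.disjoint_sdiff_left

/-- Every neighbourhood of `0` contains the lines spanned by projections `χ_C` for which `A ∩ C`
is small, where `A` is a suitable set of finite measure. -/
theorem exists_forall_smulChi_mem {U : Set M.CentralExtension}
    (hU : @IsOpen _ R.tc U) (h0 : 0 ∈ U) :
    ∃ (A : Set R.Ω) (δ : ℝ), MeasurableSet A ∧ R.μ A ≠ ∞ ∧ 0 < δ ∧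
      ∀ (C : Set R.Ω) (hC : MeasurableSet C) (hμ : R.μ C ≠ ∞),
        R.μ (A ∩ C) ≤ ENNReal.ofReal δ → ∀ c : ℂ, R.smulChi hC hμ c ∈ U := by
  -- The sets with the desired property form a filter; for intersections one takes `A ∪ A'` and `min
  -- δ δ'`. It is then enough to test the generators of the prescribed filter at `0`.
  let G : Filter M.CentralExtension :=
    { sets := {U | ∃ (A : Set R.Ω) (δ : ℝ), MeasurableSet A ∧ R.μ A ≠ ∞ ∧ 0 < δ ∧
        ∀ (C : Set R.Ω) (hC : MeasurableSet C) (hμ : R.μ C ≠ ∞),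
          R.μ (A ∩ C) ≤ ENNReal.ofReal δ → ∀ c : ℂ, R.smulChi hC hμ c ∈ U}
      univ_sets := ⟨∅, 1, .empty, by simp, one_pos, fun _ _ _ _ _ => trivial⟩
      sets_of_superset := by
        rintro U V ⟨A, δ, h1, h2, h3, h4⟩ hUV
        exact ⟨A, δ, h1, h2, h3, fun C hC hμ h c => hUV (h4 C hC hμ h c)⟩
      inter_sets := by
        rintro U V ⟨A, δ, h1, h2, h3, h4⟩ ⟨A', δ', h1', h2', h3', h4'⟩
        refine ⟨A ∪ A', min δ δ', h1.union h1', measure_union_ne_top h2 h2', lt_min h3 h3',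
          fun C hC hμ h c => ⟨h4 C hC hμ ?_ c, h4' C hC hμ ?_ c⟩⟩
        · exact (measure_mono (Set.inter_subset_inter_left _ Set.subset_union_left)).trans
            (h.trans (ENNReal.ofReal_le_ofReal (min_le_left _ _)))
        · exact (measure_mono (Set.inter_subset_inter_left _ Set.subset_union_right)).trans
            (h.trans (ENNReal.ofReal_le_ofReal (min_le_right _ _))) }
  have hle : G ≤ ⨅ (A : Set R.Ω) (ε : ℝ) (δ : ℝ)
      (_ : MeasurableSet A ∧ R.μ A < ∞ ∧ 0 < ε ∧ 0 < δ),
      Filter.principal ((fun o => (0 : M.CentralExtension) + o) '' R.O A ε δ) := by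
    simp only [le_iInf_iff, Filter.le_principal_iff]
    rintro A ε δ ⟨hA, hμA, hε, hδ⟩
    refine ⟨A, δ, hA, hμA.ne, hδ, fun C hC hμ h c => ?_⟩
    exact ⟨_, R.smulChi_mem_O hA hμA.ne hε.le hC hμ h c, zero_add _⟩
  -- An open set of the topology generated by prescribed filters belongs, by definition, to the
  -- filter at each of its points. It is not needed that these filters are the neighbourhood
  -- filters.
  exact hle (hU 0 h0)

/-- The unit ball of a norm contains no nonzero line, so projections `χ_C` whose line lies in it
vanish. This leaves no small non-null sets, and the space consists of finitely many atoms. -/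
theorem exists_isCenterBasis_of_isNormable (h : IsNormable R.tc) :
    ∃ (ι : Type) (_ : Fintype ι) (z : ι → H →L[ℂ] H), M.IsCenterBasis z := by
  let _ := R.tc
  obtain ⟨F, _, _, ⟨Φ⟩⟩ := h
  obtain ⟨A, δ, hA, hμA, hδ, hsmall⟩ := R.exists_forall_smulChi_mem
    (U := Φ ⁻¹' Metric.ball 0 1) (Metric.isOpen_ball.preimage Φ.continuous) (by simp)
  have hnull : ∀ C, MeasurableSet C → R.μ C ≠ ∞ → R.μ (A ∩ C) ≤ ENNReal.ofReal δ →
      R.μ C = 0 := by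
    intro C hC hμ hle
    have hb : ∀ c : ℂ, ‖c‖ * ‖Φ (R.smulChi hC hμ 1)‖ < 1 := by
      intro c
      have := hsmall C hC hμ hle c
      rwa [R.smulChi_eq, Set.mem_preimage, map_smul, mem_ball_zero_iff, norm_smul] at this
    have hz : Φ (R.smulChi hC hμ 1) = 0 := by
      by_contra hne
      -- This scalar normalizes a nonzero vector to norm exactly `1`, which the open unit ball
      -- excludes.
      have := hb ((‖Φ (R.smulChi hC hμ 1)‖⁻¹ : ℝ) : ℂ)
      rw [Complex.norm_real, norm_inv, norm_norm,
        inv_mul_cancel₀ (norm_ne_zero_iff.2 hne)] at this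
      exact lt_irrefl _ this
    have h1 : R.smulChi hC hμ 1 = 0 := Φ.injective (hz.trans (map_zero Φ).symm)
    have h2 := ofBounded_injective (congrArg Subtype.val h1)
    rw [one_smul] at h2
    exact (R.chi_eq_zero_iff hC hμ).1 h2
  have hcompl : R.μ Aᶜ = 0 := by
    obtain ⟨𝒥, h1, -, h3⟩ := R.directSum
    -- By the direct sum property it suffices to treat `Aᶜ ∩ S` with `S` of finite measure. It is
    -- disjoint from `A`, so the smallness condition holds trivially.
    refine h3 _ hA.compl fun S hS => ?_
    refine hnull _ (hA.compl.inter (h1 S hS).1)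
      (measure_ne_top_of_subset Set.inter_subset_right (h1 S hS).2.2.ne) ?_
    rw [← Set.inter_assoc, Set.inter_compl_self, Set.empty_inter, measure_empty]
    exact zero_le
  have hδ' : ENNReal.ofReal δ ≠ 0 := (ENNReal.ofReal_pos.2 hδ).ne'
  obtain ⟨N, hN⟩ := ENNReal.exists_nat_mul_gt hδ' hμA
  obtain ⟨ι, _, D, hD1, hD2, hD3, hD4, hD5, hD6⟩ := exists_atoms_of_le_nsmul (μ := R.μ)
    ENNReal.ofReal_ne_top (fun C hC hle => hnull C hC (hle.trans_lt ENNReal.ofReal_lt_top).ne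
      ((measure_mono Set.inter_subset_right).trans hle)) N A hA hN.le
  refine ⟨ι, inferInstance, _, R.isCenterBasis_of_atoms hD1
    (fun i => measure_ne_top_of_subset (hD3 i) hμA) hD2 hD4 ?_ hD6⟩
  refine measure_mono_null ?_ (measure_union_null hcompl hD5)
  intro x hx
  by_cases hxA : x ∈ A
  exacts [Or.inr ⟨hxA, hx⟩, Or.inl hxA]

end CenterModel

/-- The inclusion of `M` into `E(M)`. -/
noncomputable def CentralExtension.ofAlgebra (M : VonNeumannAlgebra H) :
    M.toStarSubalgebra →ₗ[ℂ] M.CentralExtension where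
  toFun a := (⟨ofBounded a.1, isCentralExtensionElement_ofBounded a.2⟩ : M.CentralExtension)
  map_add' a b := Subtype.ext (strongAdd_ofBounded a.1 b.1).symm
  map_smul' c a := Subtype.ext (strongSMul_ofBounded c a.1).symm

namespace IsCenterBasis

variable {M : VonNeumannAlgebra H} {ι : Type} [Fintype ι] {z : ι → H →L[ℂ] H}

/-! ### Operators affiliated with an algebra with finite-dimensional center -/

/-- Minimality of `z j`: the product is a scalar multiple of `z j`, and idempotency forces the
scalar to be `0` or `1`. -/
theorem proj_mul_eq (hz : M.IsCenterBasis z) {p : H →L[ℂ] H} (hp : M.center.IsProj p) (j : ι) :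
    p * z j = 0 ∨ p * z j = z j := by
  obtain ⟨k, hk⟩ := hz.span p hp.2
  have h1 : p * z j = k j • z j := by rw [hk, hz.sum_smul_mul]
  have h2 : (k j * k j) • z j = k j • z j := by
    rw [← h1, mul_smul, ← h1, ← mul_smul_comm, ← h1, ← mul_assoc, hp.1.isIdempotentElem.eq]
  have h3 : IsIdempotentElem (k j) := smul_left_injective ℂ (hz.ne_zero j) h2
  rcases IsIdempotentElem.iff_eq_zero_or_one.1 h3 with h | h
  · left; rw [h1, h, zero_smul]
  · right; rw [h1, h, one_smul]

theorem eq_of_mul_eq (hz : M.IsCenterBasis z) {a b : H →L[ℂ] H} (h : ∀ j, a * z j = b * z j) :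
    a = b := by
  rw [← mul_one a, ← mul_one b, ← hz.sum_eq_one, Finset.mul_sum, Finset.mul_sum]
  exact Finset.sum_congr rfl fun j _ => h j

/-- A sequence of central projections increasing to `1` reaches `1`. -/
theorem exists_eq_one (hz : M.IsCenterBasis z) {p : ℕ → H →L[ℂ] H}
    (hp : ∀ n, M.center.IsProj (p n)) (hi : IncreasesToOne p) : ∃ n, p n = 1 := by
  have h1 : ∀ j, ∃ n, p n * z j = z j := by
    intro j
    -- Otherwise every `p n` annihilates the range of `z j`, and the join condition gives `z j = 0`.
    by_contra! hne
    refine hz.ne_zero j ?_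
    ext ξ
    refine hi.2 _ ?_
    rintro _ ⟨n, rfl⟩
    exact congrArg (fun q : H →L[ℂ] H => q ξ) ((hz.proj_mul_eq (hp n) j).resolve_right (hne n))
  choose N hN using h1
  -- There are finitely many indices `j`, so the largest threshold serves all of them by
  -- monotonicity.
  refine ⟨Finset.univ.sup N, hz.eq_of_mul_eq fun j => ?_⟩
  have h2 := ((hp (N j)).1.le_iff_mul_eq_right (hp _).1).1
    (hi.1 (Finset.le_sup (f := N) (Finset.mem_univ j)))
  rw [one_mul]
  conv_lhs => rw [← hN j]
  rw [← mul_assoc, h2, hN]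

/-- The projections witnessing strong density are central and reach `1`, so `f` is everywhere
defined and closed, hence bounded. Thus `S(Z(M)) = Z(M)`. -/
theorem exists_eq_ofBounded_of_isMeasurable (hz : M.IsCenterBasis z) {f : H →ₗ.[ℂ] H}
    (hf : M.center.IsMeasurable f) : ∃ a ∈ M.center, f = ofBounded a := by
  obtain ⟨hc, ha, -, p, hp, hi, hD, -⟩ := hf
  obtain ⟨n, hn⟩ := hz.exists_eq_one hp hi
  obtain ⟨a, rfl⟩ := exists_eq_ofBounded_of_domain_eq_top hc <| by
    rw [eq_top_iff]
    intro ξ _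
    have := hD n ξ
    rwa [hn] at this
  exact ⟨a, mem_of_affiliated ha, rfl⟩

/-- One of the central projections on which `x` is given by an element of `M` is already `1`. -/
theorem exists_eq_ofBounded (hz : M.IsCenterBasis z) {x : H →ₗ.[ℂ] H}
    (hx : M.IsCentralExtensionElement x) : ∃ a ∈ M, x = ofBounded a := by
  obtain ⟨e, a, he, haM, hcut⟩ := hx.exists_cut
  obtain ⟨n, hn⟩ := hz.exists_eq_one he.proj he.increases
  have h1 := hcut n
  rw [hn] at h1
  exact ⟨a n, haM n, hx.eq_of_cut (isCentralExtensionElement_ofBounded (haM n)) M.exhaustion_one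
    (fun _ => h1) (fun _ _ => rfl) fun _ => rfl⟩

/-! ### The center-valued norm -/

theorem mul_comm (hz : M.IsCenterBasis z) (j : ι) {a : H →L[ℂ] H} (ha : a ∈ M) :
    a * z j = z j * a := (commute_of_mem_center (hz.proj j).2 (Or.inl ha)).symm

theorem nonneg (hz : M.IsCenterBasis z) (j : ι) : 0 ≤ z j := (hz.proj j).1.nonneg

theorem sum_ofReal_smul (r : ι → ℝ) : ∑ j, (r j : ℂ) • z j = ∑ j, r j • z j :=
  Finset.sum_congr rfl fun j _ => Complex.coe_smul (r j) (z j)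

theorem real_sum_smul_mul (hz : M.IsCenterBasis z) (r : ι → ℝ) (i : ι) :
    (∑ j, r j • z j) * z i = r i • z i := by
  rw [← sum_ofReal_smul, hz.sum_smul_mul, Complex.coe_smul]

theorem real_sum_mem (hz : M.IsCenterBasis z) (r : ι → ℝ) : ∑ j, r j • z j ∈ M.center := by
  rw [← sum_ofReal_smul]
  exact hz.sum_smul_mem _

theorem real_sum_isSelfAdjoint (hz : M.IsCenterBasis z) (r : ι → ℝ) :
    IsSelfAdjoint (∑ j, r j • z j) :=
  isSelfAdjoint_sum _ fun j _ => (IsSelfAdjoint.all (r j)).smul (hz.proj j).1.isSelfAdjoint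

/-- Taking adjoints conjugates the coefficients, and coefficients are unique. -/
theorem exists_real_of_isSelfAdjoint (hz : M.IsCenterBasis z) {a : H →L[ℂ] H}
    (ha : a ∈ M.center) (hs : IsSelfAdjoint a) : ∃ r : ι → ℝ, a = ∑ j, r j • z j := by
  obtain ⟨k, rfl⟩ := hz.span a ha
  refine ⟨fun j => (k j).re, ?_⟩
  rw [← sum_ofReal_smul]
  refine Finset.sum_congr rfl fun j _ => ?_
  have h1 := hs.star_eq
  rw [star_sum, Finset.sum_congr rfl fun j _ => by
    rw [star_smul, (hz.proj j).1.isSelfAdjoint.star_eq]] at h1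
  have h2 := congrFun (hz.coeff_injective h1) j
  congr 1
  exact (Complex.conj_eq_iff_re.1 h2).symm

theorem abs_mul_eq (hz : M.IsCenterBasis z) (j : ι) {b : H →L[ℂ] H} (hb : b ∈ M) :
    CFC.abs (b * z j) = CFC.abs b * z j := by
  have hc : Commute b (z j) := hz.mul_comm j hb
  rw [hc.cfcAbs_mul_eq (by rwa [(hz.proj j).1.isSelfAdjoint.star_eq]),
    CFC.abs_of_nonneg _ (hz.nonneg j)]

theorem abs_commute (hz : M.IsCenterBasis z) (j : ι) {b : H →L[ℂ] H} (hb : b ∈ M) :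
    Commute (z j) (CFC.abs b) := by
  have hc : Commute b (z j) := hz.mul_comm j hb
  exact hc.cfcAbs_right (by rwa [(hz.proj j).1.isSelfAdjoint.star_eq])

theorem conj_abs (hz : M.IsCenterBasis z) (j : ι) {b : H →L[ℂ] H} (hb : b ∈ M) :
    z j * CFC.abs b * z j = CFC.abs (b * z j) := by
  rw [(hz.abs_commute j hb).eq, mul_assoc, hz.mul_self, hz.abs_mul_eq j hb]

/-- The inequality splits along the central projections into `|b z_j| ≤ r_j z_j`, and for a positive
operator living under `z j` this bounds exactly its norm. The central majorants of `|b|` are thereby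
described by scalars. -/
theorem abs_le_iff (hz : M.IsCenterBasis z) {b : H →L[ℂ] H} (hb : b ∈ M) (r : ι → ℝ) :
    CFC.abs b ≤ ∑ j, r j • z j ↔ ∀ j, ‖b * z j‖ ≤ r j := by
  constructor
  · intro h j
    have h1 := conjugate_le_conjugate_of_nonneg h (hz.nonneg j)
    rw [hz.conj_abs j hb, mul_assoc, hz.real_sum_smul_mul, mul_smul_comm, hz.mul_self] at h1
    have h0 := (CFC.abs_nonneg (b * z j)).trans h1
    -- `r j • z j` dominates a positive operator and `z j ≠ 0`, so `r j` cannot be negative.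
    have hr : 0 ≤ r j := by
      by_contra! hlt
      have h2 : r j • z j ≤ 0 := smul_nonpos_of_nonpos_of_nonneg hlt.le (hz.nonneg j)
      rcases smul_eq_zero.1 (le_antisymm h2 h0) with h3 | h3
      exacts [hlt.ne h3, hz.ne_zero j h3]
    rw [← CFC.norm_abs]
    refine (CStarAlgebra.norm_le_norm_of_nonneg_of_le (CFC.abs_nonneg _) h1).trans ?_
    rw [norm_smul, Real.norm_of_nonneg hr]
    exact mul_le_of_le_one_right hr (hz.proj j).1.norm_le
  · intro h
    have h1 : CFC.abs b = ∑ j, CFC.abs (b * z j) := by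
      rw [← mul_one (CFC.abs b), ← hz.sum_eq_one, Finset.mul_sum]
      exact Finset.sum_congr rfl fun j _ => (hz.abs_mul_eq j hb).symm
    rw [h1]
    refine Finset.sum_le_sum fun j _ => ?_
    -- Conjugating `|b z_j| ≤ ‖b z_j‖ 1` by `z j` replaces `1` by `z j` and leaves the left side
    -- unchanged.
    have h2 := IsSelfAdjoint.le_algebraMap_norm_self (CFC.abs_nonneg (b * z j)).isSelfAdjoint
    have h3 := conjugate_le_conjugate_of_nonneg h2 (hz.nonneg j)
    rw [CFC.norm_abs, Algebra.algebraMap_eq_smul_one, mul_smul_comm, mul_one, smul_mul_assoc,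
      hz.mul_self, hz.abs_mul_eq j hb, ← mul_assoc, (hz.abs_commute j hb).eq, mul_assoc,
      mul_assoc, hz.mul_self, hz.mul_self, ← hz.abs_mul_eq j hb] at h3
    exact h3.trans (smul_le_smul_of_nonneg_right (h j) (hz.nonneg j))

/-- The center-valued norm of `b` is `∑ j, ‖b z_j‖ z_j`. -/
theorem isCenterNorm (hz : M.IsCenterBasis z) {b : H →L[ℂ] H} (hb : b ∈ M) :
    M.IsCenterNorm (ofBounded b) (ofBounded (∑ j, ‖b * z j‖ • z j)) := by
  have hc : M.IsCentralSelfAdjoint (ofBounded (∑ j, ‖b * z j‖ • z j)) :=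
    isCentralSelfAdjoint_ofBounded (hz.real_sum_mem _) (hz.real_sum_isSelfAdjoint _)
  refine ⟨hc, ?_, fun h _ hle => hle _ ⟨hc, _, isAbs_ofBounded_iff.2 rfl,
    opLE_ofBounded_iff.2 ((hz.abs_le_iff hb _).2 fun _ => le_rfl)⟩⟩
  rintro g ⟨hg, a, ha, hle⟩
  obtain ⟨g, hgc, rfl⟩ := hz.exists_eq_ofBounded_of_isMeasurable hg.1
  obtain ⟨r, rfl⟩ := hz.exists_real_of_isSelfAdjoint hgc (isSelfAdjoint_ofBounded_iff.1 hg.2)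
  rw [isAbs_ofBounded_iff.1 ha, opLE_ofBounded_iff, hz.abs_le_iff hb] at hle
  exact opLE_ofBounded_iff.2 <| Finset.sum_le_sum fun j _ =>
    smul_le_smul_of_nonneg_right (hle j) (hz.nonneg j)

/-- As a greatest lower bound, `f` dominates the lower bound `∑ j, ‖b z_j‖ z_j`, which in turn
dominates `|b|`. Uniqueness of the center-valued norm is not needed. -/
theorem norm_le_of_isCenterNorm (hz : M.IsCenterBasis z) {b f : H →L[ℂ] H} (hb : b ∈ M)
    (hf : M.IsCenterNorm (ofBounded b) (ofBounded f)) : ‖b‖ ≤ ‖f‖ := by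
  have h1 := opLE_ofBounded_iff.1 (hf.2.2 _ (hz.isCenterNorm hb).1 (hz.isCenterNorm hb).2.1)
  have h2 := (hz.abs_le_iff hb _).2 fun _ => le_rfl
  rw [← CFC.norm_abs]
  exact CStarAlgebra.norm_le_norm_of_nonneg_of_le (CFC.abs_nonneg b) (h2.trans h1)

theorem norm_sum_norm_smul_le (hz : M.IsCenterBasis z) (b : H →L[ℂ] H) :
    ‖∑ j, ‖b * z j‖ • z j‖ ≤ ‖b‖ := by
  have h0 : 0 ≤ ∑ j, ‖b * z j‖ • z j :=
    Finset.sum_nonneg fun j _ => smul_nonneg (norm_nonneg _) (hz.nonneg j)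
  rw [CStarAlgebra.norm_le_iff_le_algebraMap _ (norm_nonneg b) h0,
    Algebra.algebraMap_eq_smul_one, ← hz.sum_eq_one, Finset.smul_sum]
  refine Finset.sum_le_sum fun j _ => smul_le_smul_of_nonneg_right ?_ (hz.nonneg j)
  exact (norm_mul_le _ _).trans
    (mul_le_of_le_one_right (norm_nonneg b) (hz.proj j).1.norm_le)

/-! ### The topology -/

variable (R : CenterModel.{u, v} M)

/-- Up to a null set, `C` is determined by the set of indices `j` with `χ_C z_j = z_j`, and there
are finitely many such sets of indices. -/
theorem finite_measure_values (hz : M.IsCenterBasis z) :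
    {m | ∃ C, MeasurableSet C ∧ R.μ C ≠ ∞ ∧ R.μ C = m}.Finite := by
  classical
  let T := {C : Set R.Ω // MeasurableSet C ∧ R.μ C ≠ ∞}
  let F : T → Set ι := fun C => {j | R.chi C.2.1 C.2.2 * z j = z j}
  let m : T → ℝ≥0∞ := fun C => R.μ C.1
  have hfac : Function.FactorsThrough m F := by
    intro C D hCD
    refine measure_congr ((R.chi_eq_iff C.2.1 C.2.2 D.2.1 D.2.2).1 (hz.eq_of_mul_eq fun j => ?_))
    have hj : R.chi C.2.1 C.2.2 * z j = z j ↔ R.chi D.2.1 D.2.2 * z j = z j :=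
      Set.ext_iff.1 hCD j
    rcases hz.proj_mul_eq (R.chi_isProj C.2.1 C.2.2) j with h1 | h1 <;>
      rcases hz.proj_mul_eq (R.chi_isProj D.2.1 D.2.2) j with h2 | h2
    · rw [h1, h2]
    · rw [hj.2 h2, h2]
    · rw [hj.1 h1, h1]
    · rw [h1, h2]
  refine (Set.finite_range (Function.extend F m fun _ => 0)).subset ?_
  rintro _ ⟨C, hC, hμ, rfl⟩
  exact ⟨F ⟨C, hC, hμ⟩, congrFun (hfac.extend_comp fun _ => 0) ⟨C, hC, hμ⟩⟩

/-- Take `A` of maximal finite measure and `δ` smaller than every positive finite value of the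
measure. Then the complement of `A` is null, and a difference `A \ B` of measure at most `δ` is null
too. -/
theorem exists_forall_chi_eq_one (hz : M.IsCenterBasis z) :
    ∃ (A : Set R.Ω) (δ : ℝ), MeasurableSet A ∧ R.μ A < ∞ ∧ 0 < δ ∧
      ∀ (B : Set R.Ω) (hB : MeasurableSet B) (hμ : R.μ B ≠ ∞),
        R.μ (A \ B) ≤ ENNReal.ofReal δ → R.chi hB hμ = 1 := by
  have hfin := hz.finite_measure_values R
  obtain ⟨_, ⟨A, hA, hμA, rfl⟩, hmax⟩ := hfin.exists_maximal
    ⟨0, ∅, MeasurableSet.empty, by simp, measure_empty⟩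
  have hcompl : R.μ Aᶜ = 0 := by
    obtain ⟨𝒥, h1, -, h3⟩ := R.directSum
    refine h3 _ hA.compl fun S hS => ?_
    -- Adjoining `Aᶜ ∩ S` to `A` cannot increase the maximal measure, and `μ A` is finite, so the
    -- adjoined set is null.
    have hdis : Disjoint A (Aᶜ ∩ S) := Set.disjoint_left.2 fun x hx hx' => hx'.1 hx
    have hm := hA.compl.inter (h1 S hS).1
    have hu := measure_union (μ := R.μ) hdis hm
    have hne : R.μ (Aᶜ ∩ S) ≠ ∞ :=
      measure_ne_top_of_subset Set.inter_subset_right (h1 S hS).2.2.ne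
    have hle := hmax ⟨A ∪ (Aᶜ ∩ S), hA.union hm, measure_union_ne_top hμA hne, rfl⟩
      (measure_mono Set.subset_union_left)
    rw [hu] at hle
    have h4 : R.μ A + R.μ (Aᶜ ∩ S) ≤ R.μ A + 0 := by rwa [add_zero]
    exact le_zero_iff.1 ((ENNReal.add_le_add_iff_left hμA).1 h4)
  obtain ⟨δ, hδ, hsmall⟩ : ∃ δ : ℝ, 0 < δ ∧
      ∀ C, MeasurableSet C → R.μ C ≠ ∞ → R.μ C ≤ ENNReal.ofReal δ → R.μ C = 0 := by
    by_cases hne : ({m | ∃ C, MeasurableSet C ∧ R.μ C ≠ ∞ ∧ R.μ C = m} \ {0}).Nonempty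
    · obtain ⟨_, ⟨⟨C, hC, hμC, rfl⟩, hC0⟩, hmin⟩ := (hfin.sdiff (t := {0})).exists_minimal hne
      have hpos : 0 < (R.μ C).toReal := ENNReal.toReal_pos hC0 hμC
      -- Half the least positive value; if there is no positive value, any `δ` works and `1` is
      -- chosen below.
      refine ⟨(R.μ C).toReal / 2, half_pos hpos, fun D hD hμD hle => ?_⟩
      by_contra hD0
      have h1 : R.μ D < R.μ C := by
        refine hle.trans_lt ?_
        rw [ENNReal.ofReal_lt_iff_lt_toReal (half_pos hpos).le hμC]
        exact half_lt_self hpos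
      exact not_le.2 h1 (hmin ⟨⟨D, hD, hμD, rfl⟩, hD0⟩ h1.le)
    · refine ⟨1, one_pos, fun D hD hμD _ => ?_⟩
      by_contra hD0
      exact hne ⟨_, ⟨D, hD, hμD, rfl⟩, hD0⟩
  refine ⟨A, δ, hA, hμA.lt_top, hδ, fun B hB hμ hle => R.chi_eq_one hB hμ ?_⟩
  have h0 := hsmall _ (hA.diff hB) (measure_ne_top_of_subset Set.sdiff_subset hμA) hle
  refine measure_mono_null ?_ (measure_union_null hcompl h0)
  intro x hx
  by_cases hxA : x ∈ A
  exacts [Or.inr ⟨hxA, hx⟩, Or.inl hxA]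

/-- If the center of `M` is finite-dimensional, then `E(M) = M`. -/
noncomputable def linearEquiv (hz : M.IsCenterBasis z) :
    M.toStarSubalgebra ≃ₗ[ℂ] M.CentralExtension :=
  LinearEquiv.ofBijective (CentralExtension.ofAlgebra M)
    ⟨fun _ _ h => Subtype.ext (ofBounded_injective (congrArg Subtype.val h)), fun x => by
      obtain ⟨a, ha, hx⟩ := hz.exists_eq_ofBounded x.2
      exact ⟨⟨a, ha⟩, Subtype.ext hx.symm⟩⟩

/-- Nothing has to be removed from `A`: the center-valued norm has operator norm at most `‖b‖`. So
every basic neighbourhood of `0` contains a closed ball. -/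
theorem linearEquiv_mem_O (hz : M.IsCenterBasis z) {A : Set R.Ω} {ε δ : ℝ} (hA : MeasurableSet A)
    (hμA : R.μ A ≠ ∞) {b : M.toStarSubalgebra} (hb : ‖b‖ ≤ ε) :
    hz.linearEquiv b ∈ R.O A ε δ := by
  have hN := hz.isCenterNorm b.2
  refine ⟨_, hN, hN.1.1, A, hA, hμA, subset_rfl, by simp, R.chi hA hμA * _,
    mul_mem (R.chi_isProj hA hμA).2 (hz.real_sum_mem _), strongMul_ofBounded_eq_iff.2 rfl, ?_⟩
  refine (norm_mul_le _ _).trans ((mul_le_of_le_one_left (norm_nonneg _)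
    (R.chi_isProj hA hμA).1.norm_le).trans ((hz.norm_sum_norm_smul_le _).trans hb))

/-- The hypothesis makes the cut-off by `χ_B` trivial, so `ε` bounds the full center-valued norm and
hence `‖b‖`. -/
theorem norm_le_of_linearEquiv_mem_O (hz : M.IsCenterBasis z) {A : Set R.Ω} {ε δ : ℝ}
    (h : ∀ (B : Set R.Ω) (hB : MeasurableSet B) (hμ : R.μ B ≠ ∞),
      R.μ (A \ B) ≤ ENNReal.ofReal δ → R.chi hB hμ = 1)
    {b : M.toStarSubalgebra} (hb : hz.linearEquiv b ∈ R.O A ε δ) : ‖b‖ ≤ ε := by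
  obtain ⟨f, hf, -, B, hB, hμ, -, hle, a, -, ha, hae⟩ := hb
  obtain ⟨f, -, rfl⟩ := hz.exists_eq_ofBounded_of_isMeasurable hf.1.1
  rw [h B hB hμ hle, strongMul_ofBounded_eq_iff, one_mul] at ha
  rw [← ha] at hae
  exact (hz.norm_le_of_isCenterNorm b.2 hf).trans hae

/-- The prescribed filter at `x` is the norm neighbourhood filter: each `O(A, ε, δ)` contains a
ball, and for the special `A` and `δ` it is contained in one. -/
theorem tc_eq_induced (hz : M.IsCenterBasis z) :
    R.tc = TopologicalSpace.induced hz.linearEquiv.symm inferInstance := by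
  set τ : TopologicalSpace M.CentralExtension :=
    TopologicalSpace.induced hz.linearEquiv.symm inferInstance with hτ
  have key : ∀ x, @nhds _ τ x =
      ⨅ (A : Set R.Ω) (ε : ℝ) (δ : ℝ) (_ : MeasurableSet A ∧ R.μ A < ∞ ∧ 0 < ε ∧ 0 < δ),
        Filter.principal ((fun o => x + o) '' R.O A ε δ) := by
    intro x
    have hbasis : (@nhds _ τ x).HasBasis (fun r : ℝ => 0 < r)
        fun r => hz.linearEquiv.symm ⁻¹' Metric.ball (hz.linearEquiv.symm x) r := by
      rw [hτ, nhds_induced]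
      exact Metric.nhds_basis_ball.comap _
    refine le_antisymm ?_ (hbasis.ge_iff.2 fun r hr => ?_)
    · simp only [le_iInf_iff, Filter.le_principal_iff]
      rintro A ε δ ⟨hA, hμA, hε, hδ⟩
      refine hbasis.mem_iff.2 ⟨ε, hε, fun y hy => ⟨y - x, ?_, add_sub_cancel x y⟩⟩
      rw [← hz.linearEquiv.apply_symm_apply (y - x)]
      refine hz.linearEquiv_mem_O R hA hμA.ne ?_
      rw [map_sub, ← dist_eq_norm]
      exact le_of_lt hy
    · obtain ⟨A, δ, hA, hμA, hδ, h1⟩ := hz.exists_forall_chi_eq_one R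
      refine Filter.mem_of_superset (Filter.mem_iInf_of_mem A <| Filter.mem_iInf_of_mem (r / 2) <|
        Filter.mem_iInf_of_mem δ <| Filter.mem_iInf_of_mem ⟨hA, hμA, half_pos hr, hδ⟩ <|
        Filter.mem_principal_self _) ?_
      rintro _ ⟨o, ho, rfl⟩
      rw [← hz.linearEquiv.apply_symm_apply o] at ho
      have h2 := hz.norm_le_of_linearEquiv_mem_O R h1 ho
      rw [Set.mem_preimage, map_add, mem_ball_iff_norm, add_sub_cancel_left]
      exact h2.trans_lt (half_lt_self hr)
  -- Openness for `tc` means by definition membership in the prescribed filter at each point, so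
  -- equality of the filters settles it.
  refine TopologicalSpace.ext_iff.2 fun U => ?_
  rw [@isOpen_iff_mem_nhds _ τ]
  simp only [key]
  rfl

theorem isNormable (hz : M.IsCenterBasis z) : IsNormable R.tc := by
  rw [hz.tc_eq_induced R]
  let _ : TopologicalSpace M.CentralExtension :=
    TopologicalSpace.induced hz.linearEquiv.symm inferInstance
  refine ⟨M.toStarSubalgebra, inferInstance, inferInstance, ⟨⟨hz.linearEquiv.symm, ?_, ?_⟩⟩⟩
  · exact continuous_induced_dom
  · refine continuous_induced_rng.2 ?_
    have : ⇑hz.linearEquiv.symm ∘ ⇑hz.linearEquiv = id :=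
      funext hz.linearEquiv.symm_apply_apply
    change Continuous (⇑hz.linearEquiv.symm ∘ ⇑hz.linearEquiv)
    rw [this]
    exact continuous_id

/-! ### Existence of a model -/

/-- Counting measure on a copy of the index set in the required universe: functions on it are
coefficient families of central elements. -/
theorem exists_centerModel (hz : M.IsCenterBasis z) : Nonempty (CenterModel.{u, v} M) := by
  let Ω : Type v := ULift.{v} ι
  let _ : MeasurableSpace Ω := ⊤
  let μ : Measure Ω := Measure.count
  -- For counting measure only the empty set is null, so classes of functions have honest values at
  -- points.
  have hae : ∀ {f g : Ω → ℂ}, f =ᵐ[μ] g → ∀ x, f x = g x := fun h => Measure.ae_count_iff.1 h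
  let Ψ : Lp ℂ ∞ μ →ₗ[ℂ] M.center.toStarSubalgebra :=
    { toFun := fun f => ⟨∑ j, f ⟨j⟩ • z j, hz.sum_smul_mem _⟩
      map_add' := fun f g => by
        refine Subtype.ext ?_
        change ∑ j, (f + g : Lp ℂ ∞ μ) ⟨j⟩ • z j = ∑ j, f ⟨j⟩ • z j + ∑ j, g ⟨j⟩ • z j
        rw [← Finset.sum_add_distrib]
        refine Finset.sum_congr rfl fun j _ => ?_
        rw [hae (Lp.coeFn_add f g), Pi.add_apply, add_smul]
      map_smul' := fun c f => by
        refine Subtype.ext ?_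
        change ∑ j, (c • f : Lp ℂ ∞ μ) ⟨j⟩ • z j = c • ∑ j, f ⟨j⟩ • z j
        rw [Finset.smul_sum]
        refine Finset.sum_congr rfl fun j _ => ?_
        rw [hae (Lp.coeFn_smul c f), Pi.smul_apply, smul_assoc] }
  have hΨ : ∀ f, (Ψ f : H →L[ℂ] H) = ∑ j, f ⟨j⟩ • z j := fun _ => rfl
  have hbij : Function.Bijective Ψ := by
    constructor
    · intro f g h
      have h1 := hz.coeff_injective (congrArg Subtype.val h)
      refine Lp.ext (Filter.Eventually.of_forall fun x => congrFun h1 x.down)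
    · rintro ⟨c, hc⟩
      obtain ⟨k, rfl⟩ := hz.span c hc
      have hm : MemLp (fun x : Ω => k x.down) ∞ μ :=
        memLp_top_of_bound (measurable_from_top.aestronglyMeasurable) (∑ j, ‖k j‖) <|
          Filter.Eventually.of_forall fun x =>
            Finset.single_le_sum (f := fun j => ‖k j‖) (fun _ _ => norm_nonneg _)
              (Finset.mem_univ x.down)
      refine ⟨hm.toLp _, Subtype.ext ?_⟩
      rw [hΨ]
      refine Finset.sum_congr rfl fun j _ => ?_
      rw [hae hm.coeFn_toLp]
  let Φ := LinearEquiv.ofBijective Ψ hbij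
  have hcoe : ∀ (a : M.center.toStarSubalgebra) (j : ι), a.1 * z j = Φ.symm a ⟨j⟩ • z j := by
    intro a j
    have h1 : a.1 = ∑ j, Φ.symm a ⟨j⟩ • z j :=
      (congrArg Subtype.val (Φ.apply_symm_apply a)).symm
    conv_lhs => rw [h1]
    exact hz.sum_smul_mul _ j
  have hval : ∀ (a : M.center.toStarSubalgebra) (j : ι) (c : ℂ), a.1 * z j = c • z j →
      Φ.symm a ⟨j⟩ = c := fun a j c h =>
    smul_left_injective ℂ (hz.ne_zero j) ((hcoe a j).symm.trans h)
  refine ⟨{ Ω := Ω, μ := μ, directSum := ?_, iso := Φ.symm, map_mul := ?_, map_star := ?_ }⟩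
  · refine ⟨Set.range fun x : Ω => {x}, ?_, fun A _ _ => ⟨_, subset_rfl, Set.countable_range _, ?_⟩,
      fun N _ hN => ?_⟩
    · rintro _ ⟨x, rfl⟩
      have : μ {x} = 1 := Measure.count_singleton x
      simp [this]
    · refine measure_mono_null (t := ∅) ?_ measure_empty
      rintro x ⟨-, hx⟩
      exact hx ⟨{x}, ⟨x, rfl⟩, rfl⟩
    · refine Measure.count_eq_zero_iff.2 (Set.eq_empty_of_forall_notMem fun x hx => ?_)
      have h1 := Measure.count_eq_zero_iff.1 (hN _ ⟨x, rfl⟩)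
      exact Set.eq_empty_iff_forall_notMem.1 h1 x ⟨hx, rfl⟩
  · intro a b
    refine AEEqFun.ext ?_
    filter_upwards [AEEqFun.coeFn_mul (Φ.symm a : Ω →ₘ[μ] ℂ) (Φ.symm b)] with x hx
    rw [hx, Pi.mul_apply]
    refine hval (a * b) x.down _ ?_
    change a.1 * b.1 * z x.down = _
    rw [mul_assoc, hcoe b, mul_smul_comm, hcoe a, smul_smul, _root_.mul_comm]
  · intro a
    refine Lp.ext ?_
    filter_upwards [Lp.coeFn_star (Φ.symm a)] with x hx
    rw [hx, Pi.star_apply]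
    refine hval (star a) x.down _ ?_
    have h1 := congrArg star (hcoe a x.down)
    rw [star_mul, star_smul, (hz.proj _).1.isSelfAdjoint.star_eq] at h1
    rw [← h1]
    exact hz.mul_comm _ (star a).2.1

end IsCenterBasis

end VonNeumannAlgebra

/-! ### Normability and finite sums of factors -/

theorem proposition3p10 {H : Type u} [NormedAddCommGroup H] [InnerProductSpace ℂ H]
    [CompleteSpace H] (M : VonNeumannAlgebra H) :
    ((∃ R : VonNeumannAlgebra.CenterModel.{u, v} M, VonNeumannAlgebra.IsNormable R.tc) ↔
      M.IsFiniteSumOfFactors) ∧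
    ∀ R : VonNeumannAlgebra.CenterModel.{u, v} M,
      VonNeumannAlgebra.IsNormable R.tc ↔ M.IsFiniteSumOfFactors := by
  have key : ∀ R : VonNeumannAlgebra.CenterModel.{u, v} M,
      VonNeumannAlgebra.IsNormable R.tc ↔ M.IsFiniteSumOfFactors := by
    intro R
    constructor
    · intro h
      obtain ⟨_, _, _, hz⟩ := R.exists_isCenterBasis_of_isNormable h
      exact hz.isFiniteSumOfFactors
    · intro h
      obtain ⟨_, _, hz⟩ := h.exists_isCenterBasis
      exact hz.isNormable R
  -- The existential direction is the only place where an identification of the center has to be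
  -- produced.
  refine ⟨⟨fun ⟨R, h⟩ => (key R).1 h, fun h => ?_⟩, key⟩
  obtain ⟨_, _, hz⟩ := h.exists_isCenterBasis
  obtain ⟨R⟩ := hz.exists_centerModel
  exact ⟨R, hz.isNormable R⟩
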